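/- Fix an integer $n\ge 1$. **Models of $T_n$.** A model of $T_n$ is a set $M$ together with a function $\mathrm{Sel}$ assigning to every finite $X\subseteq M$ with $|X|>n$ an $n$-element subset $\mathrm{Sel}(X)\subseteq X$. Submodels (on arbitrary finite subsets), embeddings, isomorphisms and automorphisms are understood with respect to $\mathrm{Sel}$ (restricted to finite sets with more than $n$ elements). Let $C$ be a set of representatives of the isomorphism classes of models of $T_n$ whose domain is a finite subset of $\omega$. **The controlled construction.** Call a model $\mathbf F$ of $T_n$ with domain $\omega$ a *controlled limit* if, for some such $C$, it is the union of finite submodels $F_0\subseteq F_1\subseteq\cdots$ obtained as follows. Each $F_s$ has an initial segment of $\omega$ as domain, and $F_0=\emptyset$. Given $F_s$, let $(j_l)_{l<u}$ be an enumeration without repetition of all embeddings $j:F_s|_A\hookrightarrow R$ with $A\subseteq F_s$, $|A|\le s$, $R\in C$ and $|R|=|A|+1$. For every embedding $j_l:F_s|_{A_l}\hookrightarrow R_l$ one new point $a_l\in\omega$ is added, the new points being the next $u$ natural numbers, and $\mathrm{Sel}$ is defined on the subsets of $A_l\cup\{a_l\}$ in such a way that $j_l$ extends to an isomorphism from $A_l\cup\{a_l\}$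 onto $R_l$. For every other $X\subseteq F_{s+1}=F_s\cup\{a_l:l<u\}$ with $|X|>n$ (that is, $X\not\subseteq F_s$ and $X\not\subseteq A_l\cup\{a_l\}$ for all $l<u$), $\mathrm{Sel}(X)$ is the set of the $n$ largest elements of $X$. **The model.** For a controlled limit $\mathbf F$, let $\mathrm{MOD}_n$ be the permutation model whose set of atoms is the domain of $\mathbf F$, whose group $G$ is the group of all permutations $\pi$ of the atoms with $\pi(\mathrm{Sel}(X))=\mathrm{Sel}(\pi X)$ for all finite sets $X$ of atoms with $|X|>n$, and whose normal ideal is the ideal of all finite sets of atoms; that is, $\mathrm{MOD}_n$ consists of the hereditarily symmetric elements of the universe of sets over these atoms. **Theorem.** For every $n\ge1$ a controlled limit exists. For every controlled limit $\mathbf F$ and the permutation model $\mathrm{MOD}_n$ built on it: 1. Every non-empty finite model of $T_n$ is isomorphic to infinitely many submodels of $\mathbf F$, and every isomorphism between finite submodels of $\mathbf F$ extends to an automorphism of $\mathbf F$. 2. $\mathrm{MOD}_n\models n\mathrm{RC}_{\mathrm{fin}}$: in $\mathrm{MOD}_n$, every infinite set $x$ has an infinite subset $y$ with a function $f:[y]^{>n}\to[y]^n$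 such that $f(z)\subseteq z$ for all $z\in[y]^{>n}$, where $[y]^{>n}$ is the set of finite subsets of $y$ with more than $n$ elements and $[y]^n$ is the set of $n$-element subsets of $y$. 3. In $\mathrm{MOD}_n$, every infinite set either is well-orderable or has an infinite subset that is in bijection with a set of atoms. -/

import Mathlib

universe u

/-! ## Finite-subset selections: the models of the theory `T_n` -/

/-- A model of `T_n` with domain `α`: a selection function assigning to every finite subset of
`α` with more than `n` elements an `n`-element subset of it. The values of `sel` at sets with at
most `n` elements carry no information and are ignored by all notions below. -/
structure SelModel (n : ℕ) (α : Type*) where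
  sel : Finset α → Finset α
  sel_subset : ∀ X : Finset α, n < X.card → sel X ⊆ X
  card_sel : ∀ X : Finset α, n < X.card → (sel X).card = n

namespace SelModel

variable {n : ℕ} {α β : Type*}

/-- The submodel of `M` on the finite subset `B` of its domain. -/
noncomputable def restrict (M : SelModel n α) (B : Finset α) : SelModel n B where
  sel X := ((M.sel (X.map (Function.Embedding.subtype (· ∈ B)))).preimage Subtype.val
    Subtype.val_injective.injOn)
  sel_subset X hX := by
    intro b hb
    have h := M.sel_subset (X.map (Function.Embedding.subtype (· ∈ B))) (by simpa using hX)
      (Finset.mem_preimage.1 hb)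
    simpa using h
  card_sel X hX := by
    have hX' : n < (X.map (Function.Embedding.subtype (· ∈ B))).card := by simpa using hX
    refine Eq.trans ?_ (M.card_sel _ hX')
    rw [← Finset.card_map (Function.Embedding.subtype (· ∈ B))]
    congr 1
    ext b
    constructor
    · simp only [Finset.mem_map, Finset.mem_preimage]
      rintro ⟨c, hc, rfl⟩
      exact hc
    · intro hb
      have h := M.sel_subset _ hX' hb
      simp only [Finset.mem_map] at h
      obtain ⟨c, -, rfl⟩ := h
      exact Finset.mem_map.2 ⟨c, Finset.mem_preimage.2 hb, rfl⟩

/-- Embeddings of models of `T_n`. -/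
structure Emb (M : SelModel n α) (N : SelModel n β) where
  toFun : α ↪ β
  map_sel : ∀ X : Finset α, n < X.card → (M.sel X).map toFun = N.sel (X.map toFun)

/-- Isomorphisms of models of `T_n`. -/
structure Iso (M : SelModel n α) (N : SelModel n β) where
  toEquiv : α ≃ β
  map_sel : ∀ X : Finset α, n < X.card →
    (M.sel X).map toEquiv.toEmbedding = N.sel (X.map toEquiv.toEmbedding)

end SelModel

/-- A model of `T_n` whose domain is a finite subset of `ω`. -/
structure FinSelModel (n : ℕ) where
  dom : Finset ℕ
  model : SelModel n dom

/-- `C` is a set of representatives for the isomorphism classes of models of `T_n` whose domain is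
a finite subset of `ω`. -/
def IsRepresentatives {n : ℕ} (C : Set (FinSelModel n)) : Prop :=
  ∀ M : FinSelModel n, ∃! R : FinSelModel n, R ∈ C ∧ Nonempty (M.model.Iso R.model)

namespace SelModel

variable {n : ℕ}

/-- The embeddings `F|_A ↪ R` with `A ⊆ {0, …, N - 1}`, `|A| ≤ s`, `R ∈ C` and `|R| = |A| + 1`
(whence `1 ≤ |R| ≤ s + 1`). -/
structure Task (F : SelModel n ℕ) (C : Set (FinSelModel n)) (N s : ℕ) where
  ground : Finset ℕ
  ground_subset : ground ⊆ Finset.range N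
  ground_card : ground.card ≤ s
  target : FinSelModel n
  target_mem : target ∈ C
  target_card : target.dom.card = ground.card + 1
  emb : (F.restrict ground).Emb target.model

/-- The data of a stage by stage construction of the model `F` with domain `ω`.
The model `F_s` constructed at stage `s` has domain `{0, …, N s - 1}`, and
`F_{s+1}` is obtained from it by adding one new point for each of the tasks at stage `s`. -/
structure ControlledConstruction (F : SelModel n ℕ) where
  C : Set (FinSelModel n)
  isRepresentatives : IsRepresentatives C
  N : ℕ → ℕ
  N_zero : N 0 = 0
  N_mono : Monotone N
  /-- the enumeration of the tasks of stage `s` by the points added at that stage -/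
  task : ∀ s, Set.Ico (N s) (N (s + 1)) ≃ F.Task C (N s) s
  /-- the new point `a` with task `j : F|_A ↪ R` makes `F|_{A ∪ {a}}` isomorphic to `R`
  by an extension of `j` -/
  realizes : ∀ s (a : Set.Ico (N s) (N (s + 1))),
    ∃ g : (F.restrict (insert (a : ℕ) (task s a).ground)).Iso (task s a).target.model,
      ∀ b (hb : b ∈ (task s a).ground),
        g.toEquiv ⟨b, Finset.mem_insert_of_mem hb⟩ = (task s a).emb.toFun ⟨b, hb⟩
  /-- where no selection has been made yet, the `n` largest elements are selected -/
  largest : ∀ s (X : Finset ℕ), X ⊆ Finset.range (N (s + 1)) → n < X.card →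
    ¬ X ⊆ Finset.range (N s) →
    (∀ a : Set.Ico (N s) (N (s + 1)), ¬ X ⊆ insert (a : ℕ) (task s a).ground) →
    ∀ t ∈ F.sel X, ∀ x ∈ X, x ∉ F.sel X → x < t

/-- `F` is obtained by the controlled construction. -/
def IsControlledLimit (F : SelModel n ℕ) : Prop := Nonempty F.ControlledConstruction

/-- Every non-empty finite model of `T_n` is isomorphic to infinitely many submodels of `F`. -/
def IsUniversal (F : SelModel n ℕ) : Prop :=
  ∀ M : FinSelModel n, M.dom.Nonempty →
    {B : Finset ℕ | Nonempty (M.model.Iso (F.restrict B))}.Infinite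

/-- Every isomorphism between finite submodels of `F` extends to an automorphism of `F`. -/
def IsHomogeneous (F : SelModel n ℕ) : Prop :=
  ∀ (B B' : Finset ℕ) (e : (F.restrict B).Iso (F.restrict B')),
    ∃ g : F.Iso F, ∀ b : B, g.toEquiv b = (e.toEquiv b : ℕ)

/-- The group of all permutations `π` of the domain with `π (Sel X) = Sel (π X)` for all finite
`X` with more than `n` elements. -/
def autGroup {α : Type*} (F : SelModel n α) : Subgroup (Equiv.Perm α) where
  carrier := {π | ∀ X : Finset α, n < X.card →
    (F.sel X).map π.toEmbedding = F.sel (X.map π.toEmbedding)}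
  one_mem' := by
    intro X _
    have h : (1 : Equiv.Perm α).toEmbedding = Function.Embedding.refl α := rfl
    simp [h]
  mul_mem' := by
    intro π σ hπ hσ X hX
    have h : (π * σ).toEmbedding = σ.toEmbedding.trans π.toEmbedding := rfl
    rw [h, ← Finset.map_map, ← Finset.map_map, hσ X hX, hπ _ (by simpa using hX)]
  inv_mem' := by
    intro π hπ X hX
    have h : (π⁻¹ : Equiv.Perm α).toEmbedding.trans π.toEmbedding
        = Function.Embedding.refl α := by
      ext a; simp
    have h2 := hπ (X.map (π⁻¹ : Equiv.Perm α).toEmbedding) (by simpa using hX)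
    apply Finset.map_injective π.toEmbedding
    rw [h2, Finset.map_map, Finset.map_map, h]
    simp

end SelModel

/-! ## The universe of sets with atoms -/

/-- Codes for sets over a set `A` of atoms: an atom, or the set of the values of a family. -/
inductive PreZFA (A : Type) : Type (u + 1)
  | atom : A → PreZFA A
  | mk : (ι : Type u) → (ι → PreZFA A) → PreZFA A

namespace PreZFA

variable {A : Type}

/-- Extensional equality of codes. -/
def Equiv : PreZFA.{u} A → PreZFA.{u} A → Prop
  | atom a, atom b => a = b
  | mk ι f, mk κ g => (∀ i : ι, ∃ k : κ, Equiv (f i) (g k)) ∧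
      (∀ k : κ, ∃ i : ι, Equiv (f i) (g k))
  | atom _, mk _ _ => False
  | mk _ _, atom _ => False

theorem Equiv.refl : ∀ x : PreZFA.{u} A, Equiv x x
  | atom _ => by simp [Equiv]
  | mk _ f => by
    simp only [Equiv]
    exact ⟨fun i => ⟨i, Equiv.refl (f i)⟩, fun i => ⟨i, Equiv.refl (f i)⟩⟩

theorem Equiv.symm : ∀ {x y : PreZFA.{u} A}, Equiv x y → Equiv y x
  | atom _, atom _, h => by simp only [Equiv] at h ⊢; exact h.symm
  | atom _, mk _ _, h => by simp [Equiv] at h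
  | mk _ _, atom _, h => by simp [Equiv] at h
  | mk _ f, mk _ g, h => by
    simp only [Equiv] at h ⊢
    exact ⟨fun k => (h.2 k).imp fun _ hi => Equiv.symm hi,
      fun i => (h.1 i).imp fun _ hk => Equiv.symm hk⟩

theorem Equiv.trans : ∀ {x y z : PreZFA.{u} A}, Equiv x y → Equiv y z → Equiv x z
  | atom _, atom _, atom _, h, h' => by simp only [Equiv] at h h' ⊢; exact h.trans h'
  | atom _, mk _ _, _, h, _ => by simp [Equiv] at h
  | mk _ _, atom _, _, h, _ => by simp [Equiv] at h
  | _, atom _, mk _ _, _, h => by simp [Equiv] at h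
  | _, mk _ _, atom _, _, h => by simp [Equiv] at h
  | mk _ f, mk _ g, mk _ k, h, h' => by
    simp only [Equiv] at h h' ⊢
    refine ⟨fun i => ?_, fun l => ?_⟩
    · obtain ⟨j, hj⟩ := h.1 i
      obtain ⟨l, hl⟩ := h'.1 j
      exact ⟨l, Equiv.trans hj hl⟩
    · obtain ⟨j, hj⟩ := h'.2 l
      obtain ⟨i, hi⟩ := h.2 j
      exact ⟨i, Equiv.trans hi hj⟩

instance setoid : Setoid (PreZFA.{u} A) where
  r := Equiv
  iseqv := ⟨Equiv.refl, Equiv.symm, Equiv.trans⟩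

/-- `y.Mem x` says that (the set coded by) `x` is an element of `y`; atoms have no elements. -/
def Mem : PreZFA.{u} A → PreZFA.{u} A → Prop
  | atom _, _ => False
  | mk ι f, x => ∃ i : ι, Equiv x (f i)

/-- The code is that of a set, not of an atom. -/
def IsSet : PreZFA.{u} A → Prop
  | atom _ => False
  | mk _ _ => True

/-- The action of a permutation of the atoms. -/
def permute (π : Equiv.Perm A) : PreZFA.{u} A → PreZFA.{u} A
  | atom a => atom (π a)
  | mk ι f => mk ι fun i => permute π (f i)

theorem mem_congr {y y' x x' : PreZFA.{u} A} (hy : Equiv y y') (hx : Equiv x x') :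
    y.Mem x ↔ y'.Mem x' := by
  cases y with
  | atom a =>
    cases y' with
    | atom b => simp [Mem]
    | mk _ _ => simp [Equiv] at hy
  | mk ι f =>
    cases y' with
    | atom b => simp [Equiv] at hy
    | mk κ g =>
      simp only [Equiv] at hy
      simp only [Mem]
      constructor
      · rintro ⟨i, hi⟩
        obtain ⟨k, hk⟩ := hy.1 i
        exact ⟨k, (hx.symm.trans hi).trans hk⟩
      · rintro ⟨k, hk⟩
        obtain ⟨i, hi⟩ := hy.2 k
        exact ⟨i, (hx.trans hk).trans hi.symm⟩

theorem isSet_congr {x y : PreZFA.{u} A} (h : Equiv x y) : x.IsSet ↔ y.IsSet := by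
  cases x <;> cases y <;> simp_all [Equiv, IsSet]

theorem permute_congr (π : Equiv.Perm A) :
    ∀ {x y : PreZFA.{u} A}, Equiv x y → Equiv (permute π x) (permute π y)
  | atom _, atom _, h => by simp only [Equiv] at h; simp [permute, Equiv, h]
  | atom _, mk _ _, h => by simp [Equiv] at h
  | mk _ _, atom _, h => by simp [Equiv] at h
  | mk _ f, mk _ g, h => by
    simp only [Equiv] at h
    simp only [permute, Equiv]
    exact ⟨fun i => (h.1 i).imp fun _ hk => permute_congr π hk,
      fun k => (h.2 k).imp fun _ hi => permute_congr π hi⟩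

theorem permute_one : ∀ x : PreZFA.{u} A, permute 1 x = x
  | atom _ => by simp [permute]
  | mk _ f => by simp [permute, fun i => permute_one (f i)]

theorem permute_mul (π σ : Equiv.Perm A) :
    ∀ x : PreZFA.{u} A, permute (π * σ) x = permute π (permute σ x)
  | atom _ => by simp [permute]
  | mk _ f => by simp [permute, fun i => permute_mul π σ (f i)]

end PreZFA

/-- The cumulative universe of sets over the set `A` of atoms: the ground model of set theory
with atoms, with the axiom of choice. -/
def ZFA (A : Type) : Type (u + 1) := Quotient (PreZFA.setoid.{u} (A := A))

namespace ZFA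

variable {A : Type}

/-- The atom `a` as an element of the universe. -/
def atom (a : A) : ZFA.{u} A := Quotient.mk _ (PreZFA.atom a)

instance : Membership (ZFA.{u} A) (ZFA.{u} A) where
  mem y x := Quotient.liftOn₂ y x PreZFA.Mem fun _ _ _ _ hy hx =>
    propext (PreZFA.mem_congr hy hx)

/-- Being a set, as opposed to being an atom. -/
def IsSet (x : ZFA.{u} A) : Prop :=
  Quotient.liftOn x PreZFA.IsSet fun _ _ h => propext (PreZFA.isSet_congr h)

/-- Every permutation of the atoms acts on the universe, by `π • x = {π • y | y ∈ x}`. -/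
instance : MulAction (Equiv.Perm A) (ZFA.{u} A) where
  smul π x := Quotient.map (PreZFA.permute π) (fun _ _ h => PreZFA.permute_congr π h) x
  one_smul x := by
    induction x using Quotient.inductionOn with
    | h x => exact congrArg (Quotient.mk _) (PreZFA.permute_one x)
  mul_smul π σ x := by
    induction x using Quotient.inductionOn with
    | h x => exact congrArg (Quotient.mk _) (PreZFA.permute_mul π σ x)

/-- `E` is a support of `x` for the group `G`: `fix_G(E)` is contained in `sym_G(x)`. -/
def IsSupport (G : Subgroup (Equiv.Perm A)) (E : Finset A) (x : ZFA.{u} A) : Prop :=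
  ∀ π ∈ G, (∀ a ∈ E, π a = a) → π • x = x

/-- `x` is hereditarily symmetric with respect to the group `G` and the normal ideal of the
finite sets of atoms: `x` has a finite support and so has, hereditarily, each of its elements. -/
inductive HereditarilySymmetric (G : Subgroup (Equiv.Perm A)) : ZFA.{u} A → Prop
  | intro (x : ZFA.{u} A) : (∃ E : Finset A, IsSupport G E x) →
      (∀ y ∈ x, HereditarilySymmetric G y) → HereditarilySymmetric G x

end ZFA

/-! ## Set-theoretic notions evaluated in a structure

All quantifiers below range over the given structure, so that each definition says what the
corresponding formula of the language of set theory with atoms means in that structure. -/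

/-- A structure for the language of set theory with atoms: a binary relation `∈` and a predicate
distinguishing the sets from the atoms. -/
class SetStructure (M : Type*) extends Membership M M where
  IsSet : M → Prop

namespace SetStructure

variable {M : Type*} [SetStructure M]

/-- `x` is an atom. -/
def IsAtom (x : M) : Prop := ¬ IsSet x

/-- `x` is a subset of `y`. -/
def IsSubset (x y : M) : Prop := IsSet x ∧ ∀ z : M, z ∈ x → z ∈ y

/-- `z = {a, b}`. -/
def IsUnorderedPair (z a b : M) : Prop := IsSet z ∧ ∀ w : M, w ∈ z ↔ w = a ∨ w = b

/-- `p = (a, b) = {{a}, {a, b}}`. -/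
def IsPair (p a b : M) : Prop :=
  IsSet p ∧ ∀ z : M, z ∈ p ↔ IsUnorderedPair z a a ∨ IsUnorderedPair z a b

/-- `(a, b) ∈ r`. -/
def Related (r a b : M) : Prop := ∃ p : M, IsPair p a b ∧ p ∈ r

/-- `f` is a function from `x` to `y`. -/
def IsFunction (f x y : M) : Prop :=
  IsSet f ∧ (∀ p : M, p ∈ f → ∃ a b : M, a ∈ x ∧ b ∈ y ∧ IsPair p a b) ∧
    ∀ a : M, a ∈ x → ∃! b : M, Related f a b

/-- `f` is a bijection from `x` onto `y`. -/
def IsBijection (f x y : M) : Prop :=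
  IsFunction f x y ∧ ∀ b : M, b ∈ y → ∃! a : M, Related f a b

/-- `x = ∅`. -/
def IsEmptySet (x : M) : Prop := IsSet x ∧ ∀ z : M, z ∉ x

/-- `y = x ∪ {x}`. -/
def IsSuccessor (y x : M) : Prop := IsSet y ∧ ∀ z : M, z ∈ y ↔ z ∈ x ∨ z = x

/-- `I` is an inductive set. -/
def IsInductive (I : M) : Prop :=
  IsSet I ∧ (∀ e : M, IsEmptySet e → e ∈ I) ∧
    ∀ x : M, x ∈ I → ∀ y : M, IsSuccessor y x → y ∈ I

/-- `k ∈ ω`, that is, `k` belongs to all inductive sets. -/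
def IsNatural (k : M) : Prop := ∀ I : M, IsInductive I → k ∈ I

/-- `k` is the von Neumann numeral of `n`. -/
def IsNumeral : ℕ → M → Prop
  | 0, k => IsEmptySet k
  | n + 1, k => ∃ j : M, IsNumeral n j ∧ IsSuccessor k j

/-- `x` is a finite set: some natural number is in bijection with it. -/
def IsFiniteSet (x : M) : Prop :=
  IsSet x ∧ ∃ k f : M, IsNatural k ∧ IsBijection f k x

/-- `x` is an infinite set. -/
def IsInfiniteSet (x : M) : Prop := IsSet x ∧ ¬ IsFiniteSet x

/-- `x` is a set with exactly `n` elements. -/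
def HasCard (n : ℕ) (x : M) : Prop :=
  IsSet x ∧ ∃ k f : M, IsNumeral n k ∧ IsBijection f k x

/-- `x` is a finite set with more than `n` elements. -/
def HasFiniteCardGT (n : ℕ) (x : M) : Prop :=
  IsSet x ∧ ∃ m k f : M, IsNumeral n m ∧ IsNatural k ∧ m ∈ k ∧ IsBijection f k x

/-- `P = [y]^n`. -/
def IsSubsetsOfCard (n : ℕ) (P y : M) : Prop :=
  IsSet P ∧ ∀ z : M, z ∈ P ↔ IsSubset z y ∧ HasCard n z

/-- `P = [y]^{>n}`, the set of the finite subsets of `y` with more than `n` elements. -/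
def IsFiniteSubsetsOfCardGT (n : ℕ) (P y : M) : Prop :=
  IsSet P ∧ ∀ z : M, z ∈ P ↔ IsSubset z y ∧ HasFiniteCardGT n z

/-- `r` is a (strict) well-ordering of the set `x`. -/
def IsWellOrdering (r x : M) : Prop :=
  IsSet r ∧
    (∀ a : M, a ∈ x → ¬ Related r a a) ∧
    (∀ a b c : M, a ∈ x → b ∈ x → c ∈ x → Related r a b → Related r b c → Related r a c) ∧
    (∀ a b : M, a ∈ x → b ∈ x → a = b ∨ Related r a b ∨ Related r b a) ∧
    ∀ y : M, IsSubset y x → (∃ a : M, a ∈ y) →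
      ∃ a : M, a ∈ y ∧ ∀ b : M, b ∈ y → b = a ∨ Related r a b

/-- `x` is well-orderable. -/
def IsWellOrderable (x : M) : Prop := ∃ r : M, IsWellOrdering r x

/-- `x` is a set of atoms. -/
def IsSetOfAtoms (x : M) : Prop := IsSet x ∧ ∀ a : M, a ∈ x → IsAtom a

/-- The structure `M` satisfies `nRC_fin`: every infinite set `x` has an infinite subset `y` with
a function `f : [y]^{>n} → [y]^n` such that `f(z) ⊆ z` for all `z ∈ [y]^{>n}`. -/
def ModelsRCfin (n : ℕ) (M : Type*) [SetStructure M] : Prop :=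
  ∀ x : M, IsInfiniteSet x →
    ∃ y : M, IsSubset y x ∧ IsInfiniteSet y ∧
      ∃ P Q f : M, IsFiniteSubsetsOfCardGT n P y ∧ IsSubsetsOfCard n Q y ∧
        IsFunction f P Q ∧ ∀ z w : M, Related f z w → IsSubset w z

end SetStructure

/-! ## Permutation models -/

/-- The permutation model given by the set `A` of atoms, the group `G` and the normal ideal of
the finite subsets of `A`: the class of all hereditarily symmetric elements of the universe. -/
def PermutationModel {A : Type} (G : Subgroup (Equiv.Perm A)) : Type (u + 1) :=
  {x : ZFA.{u} A // ZFA.HereditarilySymmetric G x}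

/-- The membership relation and the atoms of a permutation model are those of the universe. -/
instance PermutationModel.instSetStructure {A : Type} (G : Subgroup (Equiv.Perm A)) :
    SetStructure (PermutationModel.{u} G) where
  mem y x := x.1 ∈ y.1
  IsSet x := x.1.IsSet

/-- The permutation model `MOD_n` built on the model `F` of `T_n`: the atoms are the elements of
`F`, the group is the automorphism group of `F`, and supports are finite. -/
abbrev SelModel.MOD {n : ℕ} (F : SelModel n ℕ) : Type (u + 1) :=
  PermutationModel.{u} F.autGroup

/-! Everything rests on one property of a controlled limit, `HasExtensions`: a finite partial
embedding of `F` into any model `N` extends so as to hit a prescribed further element of `N`, by a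
new point as large as desired. It holds because the problem, transported to a representative in `C`,
is a task of every sufficiently late stage. The freedom in `N` gives the strength. A finite `N`
yields universality. With `N = F`, back-and-forth yields `exists_perm` and homogeneity. An
artificial `N` on `Option ℕ` yields `exists_amalgam`: two one-point types that agree over the
intersection of their bases have a common realization.

Amalgamation controls supports (`apply_eq_of_smul_eq`). Let `E ∪ {b}` support `u`, and let `τ` fix
`E` and `u` but move `b`. For `σ` fixing `E` and moving `b`, the points `τ b` over `E ∪ {b}` and `σ
(τ b)` over `E ∪ {σ b}` are amalgamated to one point `d`. This gives two permutations that agree on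
`E ∪ {b}`, one mapping `u` to `u` and the other mapping `u` to `σ • u`. Hence `σ • u = u`, and
already `E` supports `u`.

Now let `x` be a set of the permutation model. If its elements have a common finite support,
permutations fixing that support fix all elements and all subsets of `x`, so an external
well-ordering and an external selection are available inside. Otherwise some `v ∈ x` is not
supported by a support of `x`. Enlarging that support suitably gives `E` and `b` such that `E ∪ {b}`
supports `v` and `E` does not. By the above, `π b ↦ π • v`, for `π` fixing `E`, is well defined and
injective on the orbit of `b`, which is infinite (`exists_family`). Its range is a subset of `x` in
bijection with a set of atoms, and it inherits the selection of `F`.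

A controlled limit exists because each stage has finitely many tasks and the selections that
different tasks demand on new sets never concern the same set. -/

namespace SelModel

variable {n : ℕ} {α β γ : Type*}

/-! ### Embeddings and partial embeddings -/

/-- The model of `T_n` induced on `β` by an injection into a model. -/
noncomputable def pull (M : SelModel n α) (f : β ↪ α) : SelModel n β where
  sel X := (M.sel (X.map f)).preimage f f.injective.injOn
  sel_subset X hX := by
    intro b hb
    have h := M.sel_subset (X.map f) (by simpa using hX) (Finset.mem_preimage.1 hb)
    simpa using h
  card_sel X hX := by
    have hX' : n < (X.map f).card := by simpa using hX
    refine Eq.trans ?_ (M.card_sel _ hX')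
    classical
    rw [← Finset.card_map f]
    congr 1
    ext b
    constructor
    · simp only [Finset.mem_map, Finset.mem_preimage]
      rintro ⟨c, hc, rfl⟩
      exact hc
    · intro hb
      obtain ⟨c, -, rfl⟩ := Finset.mem_map.1 (M.sel_subset _ hX' hb)
      exact Finset.mem_map.2 ⟨c, Finset.mem_preimage.2 hb, rfl⟩

theorem map_sel_pull (M : SelModel n α) (f : β ↪ α) (X : Finset β) (hX : n < X.card) :
    ((M.pull f).sel X).map f = M.sel (X.map f) := by
  have hX' : n < (X.map f).card := by simpa using hX
  ext b
  constructor
  · intro hb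
    obtain ⟨c, hc, rfl⟩ := Finset.mem_map.1 hb
    exact (Finset.mem_preimage (hf := f.injective.injOn)).1 hc
  · intro hb
    obtain ⟨c, -, rfl⟩ := Finset.mem_map.1 (M.sel_subset _ hX' hb)
    exact Finset.mem_map.2 ⟨c, (Finset.mem_preimage (hf := f.injective.injOn)).2 hb, rfl⟩

/-- The embedding of an induced model. -/
noncomputable def pullEmb (M : SelModel n α) (f : β ↪ α) : (M.pull f).Emb M :=
  ⟨f, M.map_sel_pull f⟩

/-- The inclusion of a finite submodel. -/
noncomputable def restrictEmb (M : SelModel n α) (B : Finset α) : (M.restrict B).Emb M :=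
  M.pullEmb (Function.Embedding.subtype (· ∈ B))

/-- Isomorphisms are embeddings. -/
def Iso.emb {M : SelModel n α} {N : SelModel n β} (e : M.Iso N) : M.Emb N :=
  ⟨e.toEquiv.toEmbedding, e.map_sel⟩

/-- The composition of embeddings. -/
def Emb.trans {M : SelModel n α} {N : SelModel n β} {K : SelModel n γ} (e : M.Emb N)
    (f : N.Emb K) : M.Emb K where
  toFun := e.toFun.trans f.toFun
  map_sel X hX := by
    rw [← Finset.map_map, ← Finset.map_map, e.map_sel X hX, f.map_sel _ (by simpa using hX)]

/-- A factorization of an embedding through an embedding is an embedding. -/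
def Emb.factor {M : SelModel n α} {N : SelModel n β} {K : SelModel n γ} (e : M.Emb K)
    (f : N.Emb K) (j : α → β) (hj : ∀ a, f.toFun (j a) = e.toFun a) : M.Emb N where
  toFun := ⟨j, fun a b h => e.toFun.injective (by rw [← hj, ← hj, h])⟩
  map_sel X hX := by
    set j' : α ↪ β := ⟨j, fun a b h => e.toFun.injective (by rw [← hj, ← hj, h])⟩
    have h : j'.trans f.toFun = e.toFun := by
      ext a; exact hj a
    apply Finset.map_injective f.toFun
    rw [f.map_sel _ (by simpa using hX), Finset.map_map, Finset.map_map, h, e.map_sel X hX]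

/-- A bijective embedding is an isomorphism. -/
noncomputable def Emb.iso {M : SelModel n α} {N : SelModel n β} (e : M.Emb N)
    (h : Function.Surjective e.toFun) : M.Iso N where
  toEquiv := Equiv.ofBijective e.toFun ⟨e.toFun.injective, h⟩
  map_sel := e.map_sel

/-- The identity. -/
def Iso.refl (M : SelModel n α) : M.Iso M where
  toEquiv := Equiv.refl α
  map_sel X _ := by simp

/-- The composition of isomorphisms. -/
def Iso.trans {M : SelModel n α} {N : SelModel n β} {K : SelModel n γ} (e : M.Iso N)
    (f : N.Iso K) : M.Iso K where
  toEquiv := e.toEquiv.trans f.toEquiv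
  map_sel := (e.emb.trans f.emb).map_sel

/-- The inverse isomorphism. -/
def Iso.symm {M : SelModel n α} {N : SelModel n β} (e : M.Iso N) : N.Iso M where
  toEquiv := e.toEquiv.symm
  map_sel X hX := by
    apply Finset.map_injective e.toEquiv.toEmbedding
    rw [e.map_sel _ (by simpa using hX), Finset.map_map, Finset.map_map]
    simp

/-- The function `p` is an embedding on the finite submodel `A` of `M` into `N`. -/
structure PartialEmb [DecidableEq β] (M : SelModel n α) (N : SelModel n β)
    (A : Finset α) (p : α → β) : Prop where
  injOn : Set.InjOn p A
  image_sel : ∀ X ⊆ A, n < X.card → (M.sel X).image p = N.sel (X.image p)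

namespace PartialEmb

theorem mono [DecidableEq β] {M : SelModel n α} {N : SelModel n β} {A B : Finset α} {p : α → β}
    (h : M.PartialEmb N A p) (hB : B ⊆ A) : M.PartialEmb N B p :=
  ⟨h.injOn.mono (by exact_mod_cast hB), fun X hX => h.image_sel X (hX.trans hB)⟩

theorem congr [DecidableEq β] {M : SelModel n α} {N : SelModel n β} {A : Finset α} {p q : α → β}
    (h : M.PartialEmb N A p) (hpq : ∀ a ∈ A, p a = q a) : M.PartialEmb N A q := by
  refine ⟨h.injOn.congr hpq, fun X hX hn => ?_⟩
  rw [← Finset.image_congr (f := p) (fun a ha => hpq a (hX (M.sel_subset X hn ha))),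
    ← Finset.image_congr (f := p) (fun a ha => hpq a (hX ha)), h.image_sel X hX hn]

theorem card_image [DecidableEq β] {M : SelModel n α} {N : SelModel n β} {A X : Finset α}
    {p : α → β} (h : M.PartialEmb N A p) (hX : X ⊆ A) : (X.image p).card = X.card :=
  Finset.card_image_of_injOn (h.injOn.mono (by exact_mod_cast hX))

theorem comp [DecidableEq β] [DecidableEq γ] {M : SelModel n α} {N : SelModel n β}
    {K : SelModel n γ} {A : Finset α} {p : α → β} {q : β → γ}
    (h : M.PartialEmb N A p) (h' : N.PartialEmb K (A.image p) q) :
    M.PartialEmb K A (q ∘ p) := by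
  refine ⟨h'.injOn.comp h.injOn fun a ha => ?_, fun X hX hn => ?_⟩
  · simpa using ⟨a, ha, rfl⟩
  · rw [← Finset.image_image, ← Finset.image_image, h.image_sel X hX hn,
      h'.image_sel _ (Finset.image_subset_image hX) (by rwa [h.card_image hX])]

theorem inverse [DecidableEq α] [DecidableEq β] {M : SelModel n α} {N : SelModel n β}
    {A : Finset α} {p : α → β} {q : β → α}
    (h : M.PartialEmb N A p) (hq : ∀ a ∈ A, q (p a) = a) :
    N.PartialEmb M (A.image p) q := by
  have key : ∀ X ⊆ A, (X.image p).image q = X := by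
    intro X hX
    rw [Finset.image_image]
    conv_rhs => rw [← Finset.image_id (s := X)]
    exact Finset.image_congr fun a ha => hq a (hX ha)
  refine ⟨?_, fun Y hY hn => ?_⟩
  · intro b hb b' hb' hbb
    simp only [Finset.coe_image, Set.mem_image, Finset.mem_coe] at hb hb'
    obtain ⟨a, ha, rfl⟩ := hb
    obtain ⟨a', ha', rfl⟩ := hb'
    rw [hq a ha, hq a' ha'] at hbb
    rw [hbb]
  · obtain ⟨X, hX, rfl⟩ := Finset.subset_image_iff.1 hY
    have hX : X ⊆ A := by exact_mod_cast hX
    rw [h.card_image hX] at hn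
    rw [← h.image_sel X hX hn, key X hX, key _ ((M.sel_subset X hn).trans hX)]

/-- Total functions restricted to finite sets can be updated and composed without dependent types;
this lemma and `toEmb` translate between them and embeddings of submodels. -/
theorem ofEmb [DecidableEq β] {M : SelModel n α} {N : SelModel n β} {A : Finset α}
    (e : (M.restrict A).Emb N) {p : α → β} (hp : ∀ a : A, p a = e.toFun a) :
    M.PartialEmb N A p := by
  refine ⟨?_, fun X hX hn => ?_⟩
  · intro a ha b hb hab
    have := e.toFun.injective ((hp ⟨a, ha⟩).symm.trans (hab.trans (hp ⟨b, hb⟩)))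
    simpa using this
  · classical
    obtain ⟨X', rfl⟩ : ∃ X' : Finset A, X'.map (Function.Embedding.subtype (· ∈ A)) = X :=
      ⟨X.subtype (· ∈ A), Finset.subtype_map_of_mem fun a ha => hX ha⟩
    have hn' : n < X'.card := by simpa using hn
    have key : ∀ Y : Finset A,
        (Y.map (Function.Embedding.subtype (· ∈ A))).image p = Y.map e.toFun := by
      intro Y
      rw [Finset.map_eq_image, Finset.map_eq_image, Finset.image_image]
      exact Finset.image_congr fun a _ => hp a
    rw [key, ← e.map_sel X' hn', ← key]
    exact congrArg _ ((M.restrictEmb A).map_sel X' hn').symm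

/-- A partial embedding as an embedding of a submodel. -/
noncomputable def toEmb [DecidableEq β] {M : SelModel n α} {N : SelModel n β} {A : Finset α}
    {p : α → β} (h : M.PartialEmb N A p) : (M.restrict A).Emb N where
  toFun := ⟨fun a => p a, fun a b hab => Subtype.ext (h.injOn a.2 b.2 hab)⟩
  map_sel X hn := by
    classical
    set f : A ↪ β := ⟨fun a => p a, fun a b hab => Subtype.ext (h.injOn a.2 b.2 hab)⟩
    have key : ∀ Y : Finset A,
        (Y.map (Function.Embedding.subtype (· ∈ A))).image p = Y.map f := by
      intro Y
      rw [Finset.map_eq_image, Finset.map_eq_image, Finset.image_image]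
      rfl
    rw [← key, ← key]
    have h1 := h.image_sel (X.map (Function.Embedding.subtype (· ∈ A)))
      (by intro a; simp only [Finset.mem_map]; rintro ⟨b, -, rfl⟩; exact b.2) (by simpa using hn)
    rw [← h1]
    exact congrArg _ ((M.restrictEmb A).map_sel X hn)

theorem empty [DecidableEq β] (M : SelModel n α) (N : SelModel n β) (p : α → β) :
    M.PartialEmb N ∅ p :=
  ⟨by simp, fun X hX hn => by simp [Finset.subset_empty.1 hX] at hn⟩

theorem id [DecidableEq α] (M : SelModel n α) (A : Finset α) : M.PartialEmb M A id :=
  ⟨Set.injOn_id _, fun X _ _ => by simp⟩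

theorem ofMemAutGroup [DecidableEq α] {M : SelModel n α} {π : Equiv.Perm α}
    (hπ : π ∈ M.autGroup) (A : Finset α) : M.PartialEmb M A π := by
  refine ⟨π.injective.injOn, fun X _ hn => ?_⟩
  have := hπ X hn
  rw [Finset.map_eq_image, Finset.map_eq_image] at this
  exact this

end PartialEmb

/-! ### One-point extensions in a controlled limit -/

/-- Every partial embedding of the model `F` on `ω` extends, in infinitely many ways, to a
further element of its target. -/
def HasExtensions (F : SelModel n ℕ) : Prop :=
  ∀ {β : Type} [DecidableEq β] (N : SelModel n β) (A : Finset ℕ) (p : ℕ → β) (b : β),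
    F.PartialEmb N A p → b ∉ A.image p → ∀ m : ℕ,
      ∃ a, m ≤ a ∧ a ∉ A ∧ F.PartialEmb N (insert a A) (Function.update p a b)

namespace ControlledConstruction

/-- Numbering `B` turns the submodel of `N` on it into a model on an initial segment of `ω`, which
has a representative. The range of the resulting embedding is exactly `B`. -/
theorem exists_representative {F : SelModel n ℕ} (c : F.ControlledConstruction)
    {β : Type*} (N : SelModel n β) (B : Finset β) :
    ∃ R ∈ c.C, R.dom.card = B.card ∧ ∃ e : R.model.Emb N, ∀ b, b ∈ B ↔ ∃ r, e.toFun r = b := by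
  classical
  let f : Finset.range B.card ≃ B := Finset.equivOfCardEq (by simp)
  let f' : Finset.range B.card ↪ β := f.toEmbedding.trans (Function.Embedding.subtype (· ∈ B))
  obtain ⟨R, ⟨hR, ⟨i⟩⟩, -⟩ := c.isRepresentatives ⟨Finset.range B.card, N.pull f'⟩
  refine ⟨R, hR, ?_, i.symm.emb.trans (N.pullEmb f'), fun b => ?_⟩
  · have := Fintype.card_congr i.toEquiv
    simpa using this.symm
  · constructor
    · intro hb
      refine ⟨i.toEquiv (f.symm ⟨b, hb⟩), ?_⟩
      simp [Emb.trans, Iso.emb, Iso.symm, pullEmb, f']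
    · rintro ⟨r, rfl⟩
      simp [Emb.trans, Iso.emb, Iso.symm, pullEmb, f']

/-- The embedding of the empty submodel into a one-point representative is a task of every stage, so
every stage adds a point. This makes `s ≤ N s`, and late stages contain any given finite set. -/
theorem N_lt_succ {F : SelModel n ℕ} (c : F.ControlledConstruction) (s : ℕ) :
    c.N s < c.N (s + 1) := by
  let N : SelModel n ℕ := F
  obtain ⟨R, hR, hcard, e, -⟩ := c.exists_representative N {0}
  let t : F.Task c.C (c.N s) s :=
    { ground := ∅
      ground_subset := by simp
      ground_card := by simp
      target := R
      target_mem := hR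
      target_card := by simpa using hcard
      emb :=
        { toFun := ⟨fun a => absurd a.2 (Finset.notMem_empty _),
            fun a => absurd a.2 (Finset.notMem_empty _)⟩
          map_sel := fun X hX => by
            have h := Finset.card_le_univ X
            simp at h
            simp [h] at hX } }
  have h := ((c.task s).symm t).2
  exact lt_of_le_of_lt h.1 h.2

/-- The submodel of `N` on `p '' A ∪ {b}` has a representative `R`, and `p` read in `R` is a task
with ground `A`. The point added for it is the required preimage of `b`. -/
theorem hasExtensions {F : SelModel n ℕ} (c : F.ControlledConstruction) :
    F.HasExtensions := by
  intro β _ N A p b hp hb m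
  obtain ⟨R, hR, hcard, e, he⟩ := c.exists_representative N (insert b (A.image p))
  have hN : ∀ s, s ≤ c.N s := (strictMono_nat_of_lt_succ (c.N_lt_succ)).id_le
  have hj : ∀ a : A, ∃ r, e.toFun r = p a := fun a =>
    (he _).1 (Finset.mem_insert_of_mem (Finset.mem_image_of_mem _ a.2))
  choose j hj using hj
  -- The three bounds make the new point at least `m`, allow `A` as a ground, and place `A` below `N
  -- s`.
  let s := max m (max A.card (A.sup _root_.id + 1))
  have hA : A ⊆ Finset.range (c.N s) := fun a ha => by
    have h1 : a ≤ A.sup _root_.id := Finset.le_sup (f := _root_.id) ha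
    have h2 : A.sup _root_.id + 1 ≤ s := le_max_of_le_right (le_max_right _ _)
    have h3 := hN s
    simp only [Finset.mem_range]
    omega
  let t : F.Task c.C (c.N s) s :=
    { ground := A
      ground_subset := hA
      ground_card := le_max_of_le_right (le_max_left _ _)
      target := R
      target_mem := hR
      target_card := by rw [hcard, Finset.card_insert_of_notMem hb, hp.card_image subset_rfl]
      emb := hp.toEmb.factor e j hj }
  obtain ⟨a, ha⟩ := (c.task s).surjective t
  have haN : c.N s ≤ a := a.2.1
  have haA : (a : ℕ) ∉ A := fun h => by
    have := Finset.mem_range.1 (hA h)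
    omega
  refine ⟨a, le_trans (le_max_left _ _) ((hN s).trans haN), haA, ?_⟩
  have hreal := c.realizes s a
  rw [ha] at hreal
  obtain ⟨g, hg⟩ := hreal
  have hgA : ∀ x (hx : x ∈ A), e.toFun (g.toEquiv ⟨x, Finset.mem_insert_of_mem hx⟩) = p x :=
    fun x hx => by
      rw [hg x hx]
      exact hj ⟨x, hx⟩
  refine PartialEmb.ofEmb (g.emb.trans e) ?_
  rintro ⟨x, hx⟩
  change _ = e.toFun (g.toEquiv ⟨x, hx⟩)
  by_cases hxa : x = a
  · subst hxa
    obtain ⟨r, hr⟩ := (he b).1 (Finset.mem_insert_self _ _)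
    obtain ⟨⟨y, hy⟩, rfl⟩ := g.toEquiv.surjective r
    -- The isomorphism `g` maps the points of `A` to the elements of `R` over `p '' A`, so only the
    -- new point is left for the element over `b`.
    have hya : y = a := by
      by_contra hne
      have hyA : y ∈ A := (Finset.mem_insert.1 hy).resolve_left hne
      rw [hgA y hyA] at hr
      exact hb (hr ▸ Finset.mem_image_of_mem _ hyA)
    subst hya
    simp [hr]
  · rw [Function.update_of_ne hxa, hgA x ((Finset.mem_insert.1 hx).resolve_left hxa)]

end ControlledConstruction

end SelModel

/-! ### Universality and homogeneity -/

namespace SelModel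

variable {n : ℕ}

/-- A copy of `M` is built one point at a time by extending the empty embedding. Since all its
points can be taken above any bound, finitely many copies never suffice. -/
theorem HasExtensions.isUniversal {F : SelModel n ℕ} (hF : F.HasExtensions) : F.IsUniversal := by
  intro M hM
  have key : ∀ m : ℕ, ∀ D : Finset M.dom, ∃ (A : Finset ℕ) (p : ℕ → M.dom),
      F.PartialEmb M.model A p ∧ A.image p = D ∧ ∀ a ∈ A, m ≤ a := by
    intro m D
    induction D using Finset.induction_on with
    | empty =>
      exact ⟨∅, fun _ => ⟨_, hM.choose_spec⟩, PartialEmb.empty _ _ _, by simp, by simp⟩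
    | insert b D hb ih =>
      obtain ⟨A, p, hp, rfl, hm⟩ := ih
      obtain ⟨a, hma, ha, h⟩ := hF M.model A p b hp hb m
      refine ⟨insert a A, Function.update p a b, h, ?_, ?_⟩
      · rw [Finset.image_insert, Function.update_self]
        congr 1
        exact Finset.image_congr fun x hx => Function.update_of_ne (by
          rintro rfl; exact ha hx) _ _
      · intro x hx
        rcases Finset.mem_insert.1 hx with rfl | hx
        · exact hma
        · exact hm x hx
  intro hfin
  obtain ⟨m, hm⟩ : ∃ m, ∀ B ∈ hfin.toFinset, ∀ b ∈ B, b < m := by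
    refine ⟨hfin.toFinset.sup (fun B => B.sup id + 1), fun B hB b hb => ?_⟩
    have h1 : B.sup id + 1 ≤ hfin.toFinset.sup (fun B => B.sup id + 1) :=
      Finset.le_sup (f := fun B : Finset ℕ => B.sup id + 1) hB
    have h2 : b ≤ B.sup id := Finset.le_sup (f := id) hb
    omega
  obtain ⟨A, p, hp, hA, hle⟩ := key m Finset.univ
  have hsurj : Function.Surjective hp.toEmb.toFun := by
    intro b
    obtain ⟨a, ha, rfl⟩ := Finset.mem_image.1 (hA ▸ Finset.mem_univ b)
    exact ⟨⟨a, ha⟩, rfl⟩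
  obtain ⟨a, ha, -⟩ := Finset.mem_image.1 (hA ▸ Finset.mem_univ (⟨_, hM.choose_spec⟩ : M.dom))
  have h1 := hm A (hfin.mem_toFinset.2 ⟨(hp.toEmb.iso hsurj).symm⟩) a ha
  exact absurd (hle a ha) (by omega)

/-- The partial automorphisms with finite domain. -/
structure PartialAut (F : SelModel n ℕ) where
  dom : Finset ℕ
  map : ℕ → ℕ
  isPartialEmb : F.PartialEmb F dom map

instance (F : SelModel n ℕ) : Preorder F.PartialAut where
  le p q := p.dom ⊆ q.dom ∧ ∀ a ∈ p.dom, p.map a = q.map a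
  le_refl p := ⟨subset_rfl, fun _ _ => rfl⟩
  le_trans p q r h h' := ⟨h.1.trans h'.1, fun a ha => (h.2 a ha).trans (h'.2 a (h.1 ha))⟩

theorem PartialAut.exists_mem_image {F : SelModel n ℕ} (hF : F.HasExtensions)
    (p : F.PartialAut) (b : ℕ) : ∃ q : F.PartialAut, p ≤ q ∧ b ∈ q.dom.image q.map := by
  by_cases hb : b ∈ p.dom.image p.map
  · exact ⟨p, le_rfl, hb⟩
  · obtain ⟨a, -, ha, h⟩ := hF F p.dom p.map b p.isPartialEmb hb 0
    refine ⟨⟨_, _, h⟩, ⟨Finset.subset_insert _ _, fun x hx => ?_⟩, ?_⟩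
    · exact (Function.update_of_ne (by rintro rfl; exact ha hx) _ _).symm
    · exact Finset.mem_image.2 ⟨a, Finset.mem_insert_self _ _, Function.update_self _ _ _⟩

/-- The forth step is the back step applied to the inverse partial automorphism. -/
theorem PartialAut.exists_mem_dom {F : SelModel n ℕ} (hF : F.HasExtensions)
    (p : F.PartialAut) (a : ℕ) : ∃ q : F.PartialAut, p ≤ q ∧ a ∈ q.dom := by
  have hp := p.isPartialEmb
  have hinv : ∀ x ∈ p.dom, Function.invFunOn p.map p.dom (p.map x) = x :=
    fun x hx => hp.injOn.leftInvOn_invFunOn hx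
  obtain ⟨q, hq, hqa⟩ := PartialAut.exists_mem_image hF ⟨_, _, hp.inverse hinv⟩ a
  have hqinv : ∀ x ∈ q.dom, Function.invFunOn q.map q.dom (q.map x) = x :=
    fun x hx => q.isPartialEmb.injOn.leftInvOn_invFunOn hx
  refine ⟨⟨_, _, q.isPartialEmb.inverse hqinv⟩, ⟨fun x hx => ?_, fun x hx => ?_⟩, hqa⟩
  · have hx' := Finset.mem_image_of_mem p.map hx
    exact Finset.mem_image.2 ⟨_, hq.1 hx', by rw [← hq.2 _ hx']; exact hinv x hx⟩
  · have hx' := Finset.mem_image_of_mem p.map hx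
    have h2 : q.map (p.map x) = x := by rw [← hq.2 _ hx']; exact hinv x hx
    have h3 := hqinv _ (hq.1 hx')
    rw [h2] at h3
    exact h3.symm

/-- Back-and-forth: an increasing sequence of finite partial automorphisms meets the cofinal sets
that put each point into the domain and into the range. Its union is an automorphism. -/
theorem HasExtensions.exists_perm {F : SelModel n ℕ} (hF : F.HasExtensions) {A : Finset ℕ}
    {p : ℕ → ℕ} (hp : F.PartialEmb F A p) : ∃ π ∈ F.autGroup, ∀ a ∈ A, π a = p a := by
  let D : ℕ ⊕ ℕ → Order.Cofinal F.PartialAut := fun i => match i with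
    | .inl a => ⟨{q | a ∈ q.dom}, fun q => by
        obtain ⟨r, h, h'⟩ := PartialAut.exists_mem_dom hF q a
        exact ⟨r, h', h⟩⟩
    | .inr b => ⟨{q | b ∈ q.dom.image q.map}, fun q => by
        obtain ⟨r, h, h'⟩ := PartialAut.exists_mem_image hF q b
        exact ⟨r, h', h⟩⟩
  let P : F.PartialAut := ⟨A, p, hp⟩
  let S := Order.sequenceOfCofinals P D
  have hmono : Monotone S := Order.sequenceOfCofinals.monotone P D
  have hdom : ∀ a, ∃ i, a ∈ (S i).dom := fun a =>
    ⟨_, Order.sequenceOfCofinals.encode_mem P D (.inl a)⟩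
  have himg : ∀ b, ∃ i, b ∈ (S i).dom.image (S i).map := fun b =>
    ⟨_, Order.sequenceOfCofinals.encode_mem P D (.inr b)⟩
  choose i hi using hdom
  -- The union of the sequence: any stage whose domain contains `a` gives the same value.
  let f : ℕ → ℕ := fun a => (S (i a)).map a
  have hf : ∀ k, ∀ a ∈ (S k).dom, f a = (S k).map a := by
    intro k a ha
    rcases le_total k (i a) with h | h
    · exact ((hmono h).2 a ha).symm
    · exact (hmono h).2 a (hi a)
  have hemb : ∀ X : Finset ℕ, F.PartialEmb F X f := by
    intro X
    have hk : ∃ k, X ⊆ (S k).dom := by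
      refine ⟨X.sup i, fun a ha => (hmono (Finset.le_sup ha)).1 (hi a)⟩
    obtain ⟨k, hk⟩ := hk
    exact ((S k).isPartialEmb.mono hk).congr fun a ha => (hf k a (hk ha)).symm
  have hbij : Function.Bijective f := by
    refine ⟨fun a b hab => (hemb {a, b}).injOn (by simp) (by simp) hab, fun b => ?_⟩
    obtain ⟨k, hk⟩ := himg b
    obtain ⟨a, ha, rfl⟩ := Finset.mem_image.1 hk
    exact ⟨a, hf k a ha⟩
  refine ⟨Equiv.ofBijective f hbij, fun X hX => ?_, fun a ha => ?_⟩
  · rw [Finset.map_eq_image, Finset.map_eq_image]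
    exact (hemb X).image_sel X subset_rfl hX
  -- The sequence starts with `P` itself.
  · exact hf 0 a ha

theorem HasExtensions.isHomogeneous {F : SelModel n ℕ} (hF : F.HasExtensions) :
    F.IsHomogeneous := by
  intro B B' e
  obtain ⟨π, hπ, h⟩ := hF.exists_perm (p := fun x => if hx : x ∈ B then e.toEquiv ⟨x, hx⟩ else x)
    (PartialEmb.ofEmb (e.emb.trans (F.restrictEmb B')) (by
      rintro ⟨a, ha⟩
      simp [ha]
      rfl))
  refine ⟨⟨π, hπ⟩, fun b => ?_⟩
  simp [h b b.2]

/-! ### Amalgamation and supports -/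

/-- Types of single elements over two finite sets that agree over the intersection are realized
simultaneously. -/
theorem HasExtensions.exists_amalgam {F : SelModel n ℕ} (hF : F.HasExtensions)
    {A₁ A₂ : Finset ℕ} {e₁ e₂ : ℕ} (h₁ : e₁ ∉ A₁) (h₂ : e₂ ∉ A₂)
    (h : F.PartialEmb F (insert e₁ (A₁ ∩ A₂)) (Function.update id e₁ e₂)) :
    ∃ d, F.PartialEmb F (insert e₁ A₁) (Function.update id e₁ d) ∧
      F.PartialEmb F (insert e₂ A₂) (Function.update id e₂ d) := by
  classical
  -- `none` is an ideal new point: `g e` puts it in place of `e` and keeps all other points.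
  let g : ℕ → ℕ → Option ℕ := fun e => Function.update some e none
  have hg : ∀ e, Function.Injective (g e) := by
    intro e x y hxy
    by_cases hx : x = e <;> by_cases hy : y = e <;> simp_all [g]
  have hgs : ∀ e x y, g e x = some y ↔ x ≠ e ∧ x = y := by
    intro e x y
    by_cases hx : x = e <;> simp_all [g]
  -- the relation `P f Y` says that the image of the submodel `Y` under `f` is prescribed
  let P : (ℕ → Option ℕ) → Finset ℕ → Prop := fun f Y =>
    f = some ∨ (f = g e₁ ∧ Y ⊆ insert e₁ A₁) ∨ (f = g e₂ ∧ Y ⊆ insert e₂ A₂)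
  have hPinj : ∀ {f Y}, P f Y → Function.Injective f := by
    rintro f Y (rfl | ⟨rfl, -⟩ | ⟨rfl, -⟩)
    exacts [Option.some_injective _, hg _, hg _]
  -- Two prescriptions for the same set agree as soon as they differ by a partial embedding `q` of
  -- `F`.
  have transfer : ∀ {f f' : ℕ → Option ℕ} {Y Y' : Finset ℕ} (q : ℕ → ℕ), Function.Injective f' →
      F.PartialEmb F Y q → (∀ y ∈ Y, f y = f' (q y)) → Y.image f = Y'.image f' → n < Y.card →
      (F.sel Y).image f = (F.sel Y').image f' := by
    intro f f' Y Y' q hf' hq hff hYY hn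
    have h1 : Y.image f = (Y.image q).image f' := by
      rw [Finset.image_image]
      exact Finset.image_congr hff
    have h2 : Y' = Y.image q := Finset.image_injective hf' (by rw [← hYY, h1])
    rw [h2, ← hq.image_sel Y subset_rfl hn, Finset.image_image]
    exact Finset.image_congr fun y hy => hff y (F.sel_subset Y hn hy)
  have mem_of : ∀ {f : ℕ → Option ℕ} {e : ℕ} {Y Y' : Finset ℕ}, Y.image f = Y'.image (g e) →
      ∀ y ∈ Y, f y = some y → y ∈ Y' ∧ y ≠ e := by
    intro f e Y Y' hYY y hy hfy
    obtain ⟨y', hy', h'⟩ := Finset.mem_image.1 (hYY ▸ Finset.mem_image_of_mem f hy)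
    rw [hfy, hgs] at h'
    obtain ⟨h', rfl⟩ := h'
    exact ⟨hy', h'⟩
  -- The image of `Y` does not contain `none`, so `Y'` avoids `e` and the two sets coincide; here
  -- `q` is the identity.
  have some_g : ∀ {e : ℕ} {Y Y' : Finset ℕ}, Y.image some = Y'.image (g e) → n < Y.card →
      (F.sel Y).image some = (F.sel Y').image (g e) := fun {e} {Y} {Y'} hYY hn =>
    transfer id (hg e) (PartialEmb.id F Y)
      (fun y hy => ((hgs e y y).2 ⟨(mem_of hYY y hy rfl).2, rfl⟩).symm) hYY hn
  have g_g : ∀ {Y Y' : Finset ℕ}, Y ⊆ insert e₁ A₁ → Y' ⊆ insert e₂ A₂ →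
      Y.image (g e₁) = Y'.image (g e₂) → n < Y.card →
      (F.sel Y).image (g e₁) = (F.sel Y').image (g e₂) := by
    intro Y Y' hY hY' hYY hn
    have hA : ∀ y ∈ Y, y ≠ e₁ → y ∈ A₁ ∧ y ∈ A₂ ∧ y ≠ e₂ := fun y hy hne => by
      obtain ⟨h1, h2⟩ := mem_of hYY y hy ((hgs e₁ y y).2 ⟨hne, rfl⟩)
      exact ⟨(Finset.mem_insert.1 (hY hy)).resolve_left hne,
        (Finset.mem_insert.1 (hY' h1)).resolve_left h2, h2⟩
    -- Apart from `e₁`, the points of `Y` lie in both bases. So `q` is the embedding in `h`, which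
    -- is where agreement over the intersection enters.
    refine transfer _ (hg e₂) (h.mono fun y hy => ?_) (fun y hy => ?_) hYY hn
    · by_cases hne : y = e₁
      · simp [hne]
      · simp [(hA y hy hne).1, (hA y hy hne).2.1]
    · by_cases hne : y = e₁
      · simp [hne, g]
      · rw [Function.update_of_ne hne, (hgs e₁ y y).2 ⟨hne, rfl⟩, id,
          (hgs e₂ y y).2 ⟨(hA y hy hne).2.2, rfl⟩]
  have consistent : ∀ {f f' : ℕ → Option ℕ} {Y Y' : Finset ℕ}, P f Y → P f' Y' →
      Y.image f = Y'.image f' → n < Y.card → (F.sel Y).image f = (F.sel Y').image f' := by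
    intro f f' Y Y' hP hP' hYY hn
    have hn' : n < Y'.card := by
      rwa [← Finset.card_image_of_injective Y' (hPinj hP'), ← hYY,
        Finset.card_image_of_injective Y (hPinj hP)]
    by_cases hff : f = f'
    · subst hff
      rw [Finset.image_injective (hPinj hP) hYY]
    · rcases hP with rfl | ⟨rfl, hY⟩ | ⟨rfl, hY⟩ <;> rcases hP' with rfl | ⟨rfl, hY'⟩ | ⟨rfl, hY'⟩
      · exact absurd rfl hff
      · exact some_g hYY hn
      · exact some_g hYY hn
      · exact (some_g hYY.symm hn').symm
      · exact absurd rfl hff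
      · exact g_g hY hY' hYY hn
      · exact (some_g hYY.symm hn').symm
      · exact (g_g hY' hY hYY.symm hn').symm
      · exact absurd rfl hff
  -- Prescribed values are unambiguous by `consistent`; on all other sets any choice will do.
  have exists_sel : ∀ X : Finset (Option ℕ), ∃ Z : Finset (Option ℕ), n < X.card → Z ⊆ X ∧
      Z.card = n ∧ ∀ f Y, P f Y → Y.image f = X → (F.sel Y).image f = Z := by
    intro X
    by_cases hX : ∃ f Y, P f Y ∧ Y.image f = X
    · obtain ⟨f, Y, hP, rfl⟩ := hX
      refine ⟨(F.sel Y).image f, fun hn => ?_⟩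
      rw [Finset.card_image_of_injective Y (hPinj hP)] at hn
      refine ⟨Finset.image_subset_image (F.sel_subset Y hn), ?_, fun f' Y' hP' hYY => ?_⟩
      · rw [Finset.card_image_of_injective _ (hPinj hP), F.card_sel Y hn]
      · exact (consistent hP hP' hYY.symm hn).symm
    · by_cases hn : n < X.card
      · obtain ⟨Z, hZ, hc⟩ := Finset.exists_subset_card_eq hn.le
        exact ⟨Z, fun _ => ⟨hZ, hc, fun f Y hP hY => absurd ⟨f, Y, hP, hY⟩ hX⟩⟩
      · exact ⟨∅, fun h => absurd h hn⟩
  choose sel hsel using exists_sel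
  let N : SelModel n (Option ℕ) := ⟨sel, fun X hX => (hsel X hX).1, fun X hX => (hsel X hX).2.1⟩
  have hN : ∀ (f : ℕ → Option ℕ) (A : Finset ℕ), (∀ Y ⊆ A, P f Y) → F.PartialEmb N A f := by
    intro f A hP
    refine ⟨(hPinj (hP ∅ (Finset.empty_subset _))).injOn, fun Y hY hn => ?_⟩
    exact (hsel (Y.image f) (by rwa [Finset.card_image_of_injective Y
      (hPinj (hP Y hY))])).2.2 f Y (hP Y hY) rfl
  -- A point `d` of `F` realizes the ideal point over `A₁ ∪ A₂`.
  obtain ⟨d, -, hd, hdN⟩ := hF N (A₁ ∪ A₂) some none (hN _ _ fun Y _ => .inl rfl) (by simp) 0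
  -- Reading `none` as `d` inverts the extended embedding; preceded by `g e` it is the map that
  -- replaces `e` by `d`.
  have hinv := hdN.inverse (q := fun z => z.getD d) fun a _ => by
    by_cases had : a = d <;> simp [had]
  have main : ∀ e A, F.PartialEmb N (insert e A) (g e) → A ⊆ A₁ ∪ A₂ → e ∉ A →
      F.PartialEmb F (insert e A) (Function.update id e d) := by
    intro e A hE hA he
    refine (hE.comp (hinv.mono ?_)).congr ?_
    · intro z hz
      obtain ⟨a, ha, rfl⟩ := Finset.mem_image.1 hz
      by_cases hae : a = e
      · exact Finset.mem_image.2 ⟨d, Finset.mem_insert_self _ _, by simp [g, hae]⟩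
      · have haA := hA ((Finset.mem_insert.1 ha).resolve_left hae)
        refine Finset.mem_image.2 ⟨a, Finset.mem_insert_of_mem haA, ?_⟩
        rw [Function.update_of_ne (by rintro rfl; exact hd haA)]
        simp [g, hae]
    · intro a _
      by_cases hae : a = e <;> simp [g, hae]
  refine ⟨d, main e₁ A₁ (hN _ _ fun Y hY => .inr (.inl ⟨rfl, hY⟩)) Finset.subset_union_left h₁,
    main e₂ A₂ (hN _ _ fun Y hY => .inr (.inr ⟨rfl, hY⟩)) Finset.subset_union_right h₂⟩

/-- The permutations in `autGroup` fixing the points of `E`. -/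
def Fixes (F : SelModel n ℕ) (E : Finset ℕ) (π : Equiv.Perm ℕ) : Prop :=
  π ∈ F.autGroup ∧ ∀ a ∈ E, π a = a

/-- Arbitrarily large points `a` have the same type over `E` as `b`. The extension property embeds
`a` onto `b`, so the inverse of the extending automorphism moves `b` to `a`. -/
theorem HasExtensions.infinite_orbit {F : SelModel n ℕ} (hF : F.HasExtensions) {E : Finset ℕ}
    {b : ℕ} (hb : b ∉ E) : {a | ∃ π, F.Fixes E π ∧ π b = a}.Infinite := by
  rw [Set.infinite_iff_exists_gt]
  intro m
  obtain ⟨a, hma, ha, h⟩ := hF F E id b (PartialEmb.id F E) (by simpa using hb) (m + 1)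
  obtain ⟨π, hπ, h⟩ := hF.exists_perm h
  refine ⟨a, ⟨π⁻¹, ⟨inv_mem hπ, fun x hx => ?_⟩, ?_⟩, by omega⟩
  · have := h x (Finset.mem_insert_of_mem hx)
    rw [Function.update_of_ne (by rintro rfl; exact ha hx)] at this
    rw [Equiv.Perm.inv_eq_iff_eq, this, id]
  · have := h a (Finset.mem_insert_self _ _)
    rw [Function.update_self] at this
    rw [Equiv.Perm.inv_eq_iff_eq, this]

/-- If an object is supported by `E ∪ {b}` but not by `E`, then a permutation fixing `E` and the
object also fixes `b`. -/
theorem HasExtensions.apply_eq_of_smul_eq {F : SelModel n ℕ} (hF : F.HasExtensions)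
    {Z : Type*} [MulAction (Equiv.Perm ℕ) Z] {E : Finset ℕ} {b : ℕ} {u : Z} (hb : b ∉ E)
    (hu : ∀ π, F.Fixes (insert b E) π → π • u = u) (hE : ¬ ∀ π, F.Fixes E π → π • u = u)
    {τ : Equiv.Perm ℕ} (hτ : F.Fixes E τ) (hτu : τ • u = u) : τ b = b := by
  by_contra hτb
  apply hE
  intro σ hσ
  -- If `σ` fixes `b`, the support `E ∪ {b}` suffices; otherwise `E ∪ {b}` and `E ∪ {σ b}` meet
  -- exactly in `E`.
  by_cases hσb : b = σ b
  · refine hu σ ⟨hσ.1, fun a ha => ?_⟩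
    rcases Finset.mem_insert.1 ha with rfl | ha
    exacts [hσb.symm, hσ.2 a ha]
  have hτE : τ b ∉ E := fun h => hb (by rwa [← τ.injective (hτ.2 _ h)])
  have hσE : ∀ x, σ x ∈ E → x ∈ E := fun x h => by rwa [← σ.injective (hσ.2 _ h)]
  have hinter : insert b E ∩ insert (σ b) E = E := by
    ext x
    simp only [Finset.mem_inter, Finset.mem_insert]
    constructor
    · rintro ⟨rfl | h, h' | h'⟩ <;> first | assumption | exact absurd h' hσb
    · exact fun h => ⟨.inr h, .inr h⟩
  -- The types of `τ b` and `σ (τ b)` over `E` agree because `σ` is an automorphism fixing `E`.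
  obtain ⟨d, h₁, h₂⟩ := hF.exists_amalgam (A₁ := insert b E) (A₂ := insert (σ b) E)
    (e₁ := τ b) (e₂ := σ (τ b))
    (by simp [hτb, hτE])
    (by
      rw [Finset.mem_insert, not_or]
      exact ⟨fun h => hτb (σ.injective h), fun h => hτE (hσE _ h)⟩)
    (by
      rw [hinter]
      refine (PartialEmb.ofMemAutGroup hσ.1 _).congr fun a ha => ?_
      rcases Finset.mem_insert.1 ha with rfl | ha
      · simp
      · rw [Function.update_of_ne (by rintro rfl; exact hτE ha), hσ.2 a ha, id])
  obtain ⟨π₁, hπ₁, h₁⟩ := hF.exists_perm h₁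
  obtain ⟨π₂, hπ₂, h₂⟩ := hF.exists_perm h₂
  have h₁d : π₁ (τ b) = d := by simpa using h₁ (τ b) (Finset.mem_insert_self _ _)
  have h₂d : π₂ (σ (τ b)) = d := by simpa using h₂ (σ (τ b)) (Finset.mem_insert_self _ _)
  have h₁b : π₁ b = b := by
    simpa [Function.update_of_ne (Ne.symm hτb)] using h₁ b (by simp)
  have h₂b : π₂ (σ b) = σ b := by
    have : σ b ≠ σ (τ b) := fun h => hτb (σ.injective h).symm
    simpa [Function.update_of_ne this] using h₂ (σ b) (by simp)
  have h₁E : ∀ a ∈ E, π₁ a = a := fun a ha => by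
    have : a ≠ τ b := by rintro rfl; exact hτE ha
    simpa [Function.update_of_ne this] using h₁ a (by simp [ha])
  have h₂E : ∀ a ∈ E, π₂ a = a := fun a ha => by
    have : a ≠ σ (τ b) := by rintro rfl; exact hτE (hσE _ ha)
    simpa [Function.update_of_ne this] using h₂ a (by simp [ha])
  have e₁ : (π₁ * τ) • u = u := by
    rw [mul_smul, hτu]
    refine hu π₁ ⟨hπ₁, fun a ha => ?_⟩
    rcases Finset.mem_insert.1 ha with rfl | ha
    exacts [h₁b, h₁E a ha]
  -- `σ⁻¹ π₂ σ` fixes `E ∪ {b}`, hence `u`, because `π₂` fixes `E ∪ {σ b}`.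
  have e₂ : (π₂ * σ * τ) • u = σ • u := by
    rw [mul_smul, hτu, ← inv_smul_eq_iff, ← mul_smul]
    refine hu _ ⟨mul_mem (inv_mem hσ.1) (mul_mem hπ₂ hσ.1), fun a ha => ?_⟩
    rw [Equiv.Perm.mul_apply, Equiv.Perm.inv_eq_iff_eq, Equiv.Perm.mul_apply]
    rcases Finset.mem_insert.1 ha with rfl | ha
    · exact h₂b
    · rw [hσ.2 a ha, h₂E a ha]
  -- Both products map `b` to `d` and fix `E`, so they act alike on `u`.
  have e₃ : ((π₂ * σ * τ)⁻¹ * (π₁ * τ)) • u = u := by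
    refine hu _ ⟨mul_mem (inv_mem (mul_mem (mul_mem hπ₂ hσ.1) hτ.1)) (mul_mem hπ₁ hτ.1),
      fun a ha => ?_⟩
    rw [Equiv.Perm.mul_apply, Equiv.Perm.inv_eq_iff_eq]
    simp only [Equiv.Perm.mul_apply]
    rcases Finset.mem_insert.1 ha with rfl | ha
    · rw [h₁d, h₂d]
    · rw [hτ.2 a ha, hσ.2 a ha, h₁E a ha, h₂E a ha]
  rw [mul_smul, inv_smul_eq_iff, e₁, e₂] at e₃
  exact e₃.symm

end SelModel

/-! ### Existence of controlled limits -/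

theorem exists_isRepresentatives (n : ℕ) : ∃ C : Set (FinSelModel n), IsRepresentatives C := by
  let S : Setoid (FinSelModel n) :=
    ⟨fun M N => Nonempty (M.model.Iso N.model), fun M => ⟨.refl _⟩, fun ⟨e⟩ => ⟨e.symm⟩,
      fun ⟨e⟩ ⟨f⟩ => ⟨e.trans f⟩⟩
  refine ⟨Set.range (Quotient.out (s := S)), fun M => ⟨Quotient.out (s := S) ⟦M⟧,
    ⟨⟨_, rfl⟩, S.symm (Quotient.mk_out (s := S) M)⟩, ?_⟩⟩
  rintro _ ⟨⟨q, rfl⟩, h⟩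
  congr 1
  rw [← Quotient.out_eq (s := S) q]
  exact (Quotient.sound (s := S) h).symm

/-- Transport to `Fin k` leaves finitely many selection functions. Representatives with the same
transported function are isomorphic, hence equal. -/
theorem IsRepresentatives.finite_card_eq {n : ℕ} {C : Set (FinSelModel n)}
    (hC : IsRepresentatives C) (k : ℕ) : {R | R ∈ C ∧ R.dom.card = k}.Finite := by
  let code : {R | R ∈ C ∧ R.dom.card = k} → (Finset (Fin k) → Finset (Fin k)) := fun R =>
    (R.1.model.pull (Finset.equivFinOfCardEq R.2.2).symm.toEmbedding).sel
  refine Set.finite_coe_iff.1 (Finite.of_injective code fun R R' h => ?_)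
  let e := (Finset.equivFinOfCardEq R.2.2).symm
  let e' := (Finset.equivFinOfCardEq R'.2.2).symm
  have hmodel : R.1.model.pull e.toEmbedding = R'.1.model.pull e'.toEmbedding := by
    have h' : (R.1.model.pull e.toEmbedding).sel = (R'.1.model.pull e'.toEmbedding).sel := h
    revert h'
    generalize R.1.model.pull e.toEmbedding = P
    generalize R'.1.model.pull e'.toEmbedding = Q
    intro h'
    cases P
    cases Q
    cases h'
    rfl
  have i := (R.1.model.pullEmb e.toEmbedding).iso e.surjective
  have i' := (R'.1.model.pullEmb e'.toEmbedding).iso e'.surjective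
  rw [← hmodel] at i'
  exact Subtype.ext ((hC R.1).unique ⟨R.2.1, ⟨.refl _⟩⟩ ⟨R'.2.1, ⟨i.symm.trans i'⟩⟩)

namespace SelModel

variable {n : ℕ}

/-- An equality and not just an isomorphism, so that tasks and stages can be rewritten when the
model under construction is replaced by a later one or by the limit. -/
theorem restrict_congr {α : Type*} {F F' : SelModel n α} {B : Finset α}
    (h : ∀ X ⊆ B, F.sel X = F'.sel X) : F.restrict B = F'.restrict B := by
  have h' : (F.restrict B).sel = (F'.restrict B).sel := by
    funext X
    ext b
    simp only [restrict, Finset.mem_preimage]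
    rw [h]
    intro a
    simp only [Finset.mem_map]
    rintro ⟨b, -, rfl⟩
    exact b.2
  revert h'
  generalize F.restrict B = P
  generalize F'.restrict B = Q
  intro h'
  cases P
  cases Q
  cases h'
  rfl

/-- The tasks at a stage only depend on the model constructed so far. -/
def Task.congr {F F' : SelModel n ℕ} {C : Set (FinSelModel n)} {N s : ℕ}
    (h : ∀ X ⊆ Finset.range N, F.sel X = F'.sel X) (t : F.Task C N s) : F'.Task C N s :=
  { t with
    emb :=
      { toFun := t.emb.toFun
        map_sel := by
          rw [← restrict_congr fun X hX => h X (hX.trans t.ground_subset)]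
          exact t.emb.map_sel } }

/-- The tasks at a stage only depend on the model constructed so far. -/
def taskEquiv {F F' : SelModel n ℕ} {C : Set (FinSelModel n)} {N : ℕ}
    (h : ∀ X ⊆ Finset.range N, F.sel X = F'.sel X) (s : ℕ) : F.Task C N s ≃ F'.Task C N s where
  toFun := Task.congr h
  invFun := Task.congr fun X hX => (h X hX).symm
  left_inv _ := rfl
  right_inv _ := rfl

/-- A task is determined by its ground, its target and a map between finite sets, and there are
finitely many representatives with at most `s + 1` points. Finiteness lets the new points form an
interval of natural numbers. -/
theorem finite_task (F : SelModel n ℕ) {C : Set (FinSelModel n)} (hC : IsRepresentatives C)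
    (N s : ℕ) : Finite (F.Task C N s) := by
  have hfin : {R | R ∈ C ∧ R.dom.card ≤ s + 1}.Finite := by
    refine ((Set.finite_Iic (s + 1)).biUnion fun k _ => hC.finite_card_eq k).subset ?_
    rintro R ⟨hR, hk⟩
    exact Set.mem_biUnion (Set.mem_Iic.2 hk) ⟨hR, rfl⟩
  have := hfin.to_subtype
  let code : F.Task C N s → Σ g : {g : Finset ℕ // g ∈ (Finset.range N).powerset},
      Σ R : {R : FinSelModel n // R ∈ C ∧ R.dom.card ≤ s + 1}, (g.1 → R.1.dom) := fun t =>
    ⟨⟨t.ground, Finset.mem_powerset.2 t.ground_subset⟩, ⟨t.target, t.target_mem, by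
      have := t.ground_card
      have := t.target_card
      omega⟩, t.emb.toFun⟩
  refine Finite.of_injective (β := Σ g : {g : Finset ℕ // g ∈ (Finset.range N).powerset},
      Σ R : {R // R ∈ {R : FinSelModel n | R ∈ C ∧ R.dom.card ≤ s + 1}}, (g.1 → R.1.dom))
      code ?_
  rintro ⟨g, h1, h2, R, h3, h4, e, he⟩ ⟨g', h1', h2', R', h3', h4', e', he'⟩ h
  simp only [code, Sigma.mk.injEq, Subtype.mk.injEq] at h
  obtain ⟨rfl, h⟩ := h
  simp only [heq_eq_eq, Sigma.mk.injEq, Subtype.mk.injEq] at h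
  obtain ⟨rfl, h⟩ := h
  simp only [heq_eq_eq, DFunLike.coe_fn_eq] at h
  subst h
  rfl

/-- One stage of the controlled construction, from `{0, …, N - 1}` to `{0, …, N' - 1}`. -/
structure Stage (F : SelModel n ℕ) (C : Set (FinSelModel n)) (N N' s : ℕ) where
  task : Set.Ico N N' ≃ F.Task C N s
  realizes : ∀ (a : Set.Ico N N'),
    ∃ g : (F.restrict (insert (a : ℕ) (task a).ground)).Iso (task a).target.model,
      ∀ b (hb : b ∈ (task a).ground),
        g.toEquiv ⟨b, Finset.mem_insert_of_mem hb⟩ = (task a).emb.toFun ⟨b, hb⟩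
  largest : ∀ (X : Finset ℕ), X ⊆ Finset.range N' → n < X.card →
    ¬ X ⊆ Finset.range N →
    (∀ a : Set.Ico N N', ¬ X ⊆ insert (a : ℕ) (task a).ground) →
    ∀ t ∈ F.sel X, ∀ x ∈ X, x ∉ F.sel X → x < t

/-- A stage only depends on the model constructed in it. -/
def Stage.congr {F F' : SelModel n ℕ} {C : Set (FinSelModel n)} {N N' s : ℕ} (hN : N ≤ N')
    (h : ∀ X ⊆ Finset.range N', F.sel X = F'.sel X) (S : F.Stage C N N' s) :
    F'.Stage C N N' s where
  task := S.task.trans (taskEquiv (fun X hX => h X (hX.trans (Finset.range_mono hN))) s)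
  realizes a := by
    change ∃ g : (F'.restrict (insert (a : ℕ) (S.task a).ground)).Iso (S.task a).target.model,
      ∀ b (hb : b ∈ (S.task a).ground),
        g.toEquiv ⟨b, Finset.mem_insert_of_mem hb⟩ = (S.task a).emb.toFun ⟨b, hb⟩
    rw [← restrict_congr fun X hX => h X (hX.trans ?_)]
    · exact S.realizes a
    · refine Finset.insert_subset (Finset.mem_range.2 a.2.2) ?_
      exact (S.task a).ground_subset.trans (Finset.range_mono hN)
  largest X hX hn hXN ha := by
    rw [← h X hX]
    exact S.largest X hX hn hXN ha

theorem exists_largest (n : ℕ) (X : Finset ℕ) (hn : n ≤ X.card) :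
    ∃ Z ⊆ X, Z.card = n ∧ ∀ t ∈ Z, ∀ x ∈ X, x ∉ Z → x < t := by
  induction n with
  | zero => exact ⟨∅, by simp, by simp, by simp⟩
  | succ n ih =>
    obtain ⟨Z, hZ, hc, h⟩ := ih (by omega)
    have hne : (X \ Z).Nonempty := by
      rw [← Finset.card_pos, Finset.card_sdiff_of_subset hZ]
      omega
    have hm := Finset.mem_sdiff.1 ((X \ Z).max'_mem hne)
    refine ⟨insert ((X \ Z).max' hne) Z, Finset.insert_subset hm.1 hZ, ?_, fun t ht x hx hxZ => ?_⟩
    · rw [Finset.card_insert_of_notMem hm.2, hc]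
    · rw [Finset.mem_insert, not_or] at hxZ
      rcases Finset.mem_insert.1 ht with rfl | ht
      · exact lt_of_le_of_ne ((X \ Z).le_max' x (Finset.mem_sdiff.2 ⟨hx, hxZ.2⟩)) hxZ.1
      · exact h t ht x hx hxZ.2

/-- Each new point imposes the selection of its target on the subsets of its ground together with
itself. Such a subset either is old, where the old selection already complies, or contains the new
point and so belongs to no other task. -/
theorem exists_stage (F : SelModel n ℕ) {C : Set (FinSelModel n)} (hC : IsRepresentatives C)
    (N s : ℕ) : ∃ (N' : ℕ) (F' : SelModel n ℕ), N ≤ N' ∧ (∀ X ⊆ Finset.range N, F.sel X = F'.sel X) ∧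
      Nonempty (F'.Stage C N N' s) := by
  classical
  have := F.finite_task hC N s
  let N' := N + Nat.card (F.Task C N s)
  let T : Set.Ico N N' ≃ F.Task C N s := Classical.choice (Finite.card_eq.1 (by simp [N']))
  -- The target has one element more than the ground, so the embedding misses some `r t`; this
  -- becomes the image of the new point.
  have hr : ∀ t : F.Task C N s, ∃ r, ∀ b, t.emb.toFun b ≠ r := by
    intro t
    by_contra! h
    have h1 := Fintype.card_le_of_surjective t.emb.toFun h
    have h2 := t.target_card
    simp only [Fintype.card_coe] at h1
    omega
  choose r hr using hr
  let φ : ∀ t : F.Task C N s, ℕ → t.target.dom := fun t x =>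
    if h : x ∈ t.ground then t.emb.toFun ⟨x, h⟩ else r t
  have hφ : ∀ a : Set.Ico N N', Set.InjOn (φ (T a)) (insert (a : ℕ) (T a).ground : Finset ℕ) := by
    intro a x hx y hy hxy
    simp only [Finset.coe_insert, Set.mem_insert_iff, Finset.mem_coe] at hx hy
    by_cases hx' : x ∈ (T a).ground <;> by_cases hy' : y ∈ (T a).ground
    · simpa [φ, hx', hy'] using hxy
    · simp only [φ, hx', hy', dif_pos, dif_neg, not_false_eq_true] at hxy
      exact absurd hxy (hr _ _)
    · simp only [φ, hx', hy', dif_pos, dif_neg, not_false_eq_true] at hxy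
      exact absurd hxy.symm (hr _ _)
    · rw [hx.resolve_right hx', hy.resolve_right hy']
  have hφF : ∀ t : F.Task C N s, F.PartialEmb t.target.model t.ground (φ t) := fun t =>
    PartialEmb.ofEmb t.emb (by rintro ⟨a, ha⟩; simp [φ, ha])
  have hground : ∀ (a : Set.Ico N N') (X : Finset ℕ), X ⊆ insert (a : ℕ) (T a).ground →
      X ⊆ Finset.range N → X ⊆ (T a).ground := by
    intro a X hX hXN x hx
    refine (Finset.mem_insert.1 (hX hx)).resolve_left ?_
    rintro rfl
    exact absurd a.2.1 (not_le.2 (Finset.mem_range.1 (hXN hx)))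
  have hunique : ∀ (a a' : Set.Ico N N') (X : Finset ℕ), ¬ X ⊆ Finset.range N →
      X ⊆ insert (a : ℕ) (T a).ground → X ⊆ insert (a' : ℕ) (T a').ground → a = a' := by
    intro a a' X hXN hX hX'
    obtain ⟨x, hx, hxN⟩ := Finset.not_subset.1 hXN
    have h1 : x = a := (Finset.mem_insert.1 (hX hx)).resolve_right
      fun h => hxN ((T a).ground_subset h)
    have h2 : x = a' := (Finset.mem_insert.1 (hX' hx)).resolve_right
      fun h => hxN ((T a').ground_subset h)
    exact Subtype.ext (h1.symm.trans h2)
  have exists_sel : ∀ X : Finset ℕ, ∃ Z : Finset ℕ, (X ⊆ Finset.range N → F.sel X = Z) ∧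
      (n < X.card → Z ⊆ X ∧ Z.card = n ∧
        (∀ a : Set.Ico N N', X ⊆ insert (a : ℕ) (T a).ground →
          Z.image (φ (T a)) = (T a).target.model.sel (X.image (φ (T a)))) ∧
        (¬ X ⊆ Finset.range N → (∀ a : Set.Ico N N', ¬ X ⊆ insert (a : ℕ) (T a).ground) →
          ∀ t ∈ Z, ∀ x ∈ X, x ∉ Z → x < t)) := by
    intro X
    by_cases hXN : X ⊆ Finset.range N
    · exact ⟨F.sel X, fun _ => rfl, fun hn => ⟨F.sel_subset X hn, F.card_sel X hn,
        fun a ha => (hφF _).image_sel X (hground a X ha hXN) hn, fun h => absurd hXN h⟩⟩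
    · by_cases hn : n < X.card
      · by_cases hX : ∃ a : Set.Ico N N', X ⊆ insert (a : ℕ) (T a).ground
        · obtain ⟨a, ha⟩ := hX
          -- The selection of the target is pulled back along the injection `φ (T a)`; `hunique`
          -- excludes a conflict with another task.
          have hinj := (hφ a).mono (Finset.coe_subset.2 ha)
          have hn' : n < (X.image (φ (T a))).card := by rwa [Finset.card_image_of_injOn hinj]
          obtain ⟨Z, hZ, hZs⟩ := Finset.subset_image_iff.1 ((T a).target.model.sel_subset _ hn')
          refine ⟨Z, fun h => absurd h hXN, fun _ => ⟨by exact_mod_cast hZ, ?_,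
            fun a' ha' => ?_, fun _ h => absurd ha (h a)⟩⟩
          · rw [← Finset.card_image_of_injOn (hinj.mono hZ), hZs,
              (T a).target.model.card_sel _ hn']
          · obtain rfl := hunique a a' X hXN ha ha'
            exact hZs
        · obtain ⟨Z, hZ, hc, h⟩ := exists_largest n X hn.le
          exact ⟨Z, fun h => absurd h hXN, fun _ => ⟨hZ, hc, fun a ha => absurd ⟨a, ha⟩ hX,
            fun _ _ => h⟩⟩
      · exact ⟨∅, fun h => absurd h hXN, fun h => absurd h hn⟩
  choose sel hsel hsel' using exists_sel
  let F' : SelModel n ℕ :=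
    ⟨sel, fun X hX => (hsel' X hX).1, fun X hX => (hsel' X hX).2.1⟩
  have hF' : ∀ a : Set.Ico N N', F'.PartialEmb (T a).target.model (insert (a : ℕ) (T a).ground) (φ (T a)) :=
    fun a => ⟨hφ a, fun X hX hn => (hsel' X hn).2.2.1 a hX⟩
  refine ⟨N', F', Nat.le_add_right _ _, hsel, ⟨T.trans (taskEquiv hsel s), fun a => ?_,
    fun X _ hn => (hsel' X hn).2.2.2⟩⟩
  have hsurj : Function.Surjective (hF' a).toEmb.toFun := by
    refine ((Fintype.bijective_iff_injective_and_card _).2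
      ⟨(hF' a).toEmb.toFun.injective, ?_⟩).surjective
    have h1 : (a : ℕ) ∉ (T a).ground := fun h =>
      absurd a.2.1 (not_le.2 (Finset.mem_range.1 ((T a).ground_subset h)))
    rw [Fintype.card_coe, Fintype.card_coe, Finset.card_insert_of_notMem h1, (T a).target_card]
  refine ⟨(hF' a).toEmb.iso hsurj, fun b hb => ?_⟩
  have hb' : b ∈ (T a).ground := hb
  change φ (T a) b = (T a).emb.toFun ⟨b, hb'⟩
  simp [φ, hb']

/-- Stages are iterated, and each finite set receives the value from any stage that contains it.
Later stages do not change that value, so every stage passes to the limit. -/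
theorem exists_isControlledLimit (n : ℕ) : ∃ F : SelModel n ℕ, F.IsControlledLimit := by
  obtain ⟨C, hC⟩ := exists_isRepresentatives n
  have hF₀ : ∀ X : Finset ℕ, ∃ Z : Finset ℕ, n < X.card → Z ⊆ X ∧ Z.card = n := by
    intro X
    by_cases hn : n < X.card
    · obtain ⟨Z, hZ⟩ := Finset.exists_subset_card_eq hn.le
      exact ⟨Z, fun _ => hZ⟩
    · exact ⟨∅, fun h => absurd h hn⟩
  choose sel₀ hsel₀ using hF₀
  -- An arbitrary starting model: the initial segment of stage `0` is empty, so none of its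
  -- selections matters.
  let F₀ : SelModel n ℕ := ⟨sel₀, fun X hX => (hsel₀ X hX).1, fun X hX => (hsel₀ X hX).2⟩
  choose N' F' hN' hF' S using fun (q : ℕ × SelModel n ℕ) s => exists_stage q.2 hC q.1 s
  let Q : ℕ → ℕ × SelModel n ℕ := fun s => Nat.rec (0, F₀) (fun s q => (N' q s, F' q s)) s
  have hmono : Monotone fun s => (Q s).1 := monotone_nat_of_le_succ fun s => hN' (Q s) s
  have hagree : ∀ s t, s ≤ t → ∀ X ⊆ Finset.range (Q s).1, (Q s).2.sel X = (Q t).2.sel X := by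
    intro s t hst X hX
    induction t, hst using Nat.le_induction with
    | base => rfl
    | succ t hst ih =>
      exact ih.trans (hF' (Q t) t X (hX.trans (Finset.range_mono (hmono hst))))
  have hlim : ∀ X : Finset ℕ, ∃ Z : Finset ℕ, (n < X.card → Z ⊆ X ∧ Z.card = n) ∧
      ∀ s, X ⊆ Finset.range (Q s).1 → (Q s).2.sel X = Z := by
    intro X
    by_cases h : ∃ s, X ⊆ Finset.range (Q s).1
    · obtain ⟨s, hs⟩ := h
      refine ⟨(Q s).2.sel X, fun hn => ⟨(Q s).2.sel_subset X hn, (Q s).2.card_sel X hn⟩,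
        fun t ht => ?_⟩
      rcases le_total s t with hst | hst
      · exact (hagree s t hst X hs).symm
      · exact hagree t s hst X ht
    · exact ⟨sel₀ X, hsel₀ X, fun s hs => absurd ⟨s, hs⟩ h⟩
  choose sel hsel hsel' using hlim
  let F : SelModel n ℕ := ⟨sel, fun X hX => (hsel X hX).1, fun X hX => (hsel X hX).2⟩
  let S' : ∀ s, F.Stage C (Q s).1 (Q (s + 1)).1 s := fun s =>
    (Classical.choice (S (Q s) s)).congr (hN' (Q s) s) fun X hX => hsel' X (s + 1) hX
  exact ⟨F, ⟨
    { C := C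
      isRepresentatives := hC
      N := fun s => (Q s).1
      N_zero := rfl
      N_mono := hmono
      task := fun s => (S' s).task
      realizes := fun s => (S' s).realizes
      largest := fun s => (S' s).largest }⟩⟩

end SelModel

/-! ### The universe with atoms -/

namespace ZFA

variable {A : Type}

/-- The set of the values of a family. -/
noncomputable def ofFamily {ι : Type u} (f : ι → ZFA.{u} A) : ZFA.{u} A :=
  Quotient.mk _ (PreZFA.mk ι fun i => (f i).out)

theorem mem_ofFamily {ι : Type u} {f : ι → ZFA.{u} A} {z : ZFA.{u} A} :
    z ∈ ofFamily f ↔ ∃ i, z = f i := by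
  induction z using Quotient.inductionOn with
  | h z =>
    exact exists_congr fun i =>
      ⟨fun h => (Quotient.sound h).trans (Quotient.out_eq (f i)),
        fun h => Quotient.exact (h.trans (Quotient.out_eq (f i)).symm)⟩

theorem isSet_ofFamily {ι : Type u} (f : ι → ZFA.{u} A) : (ofFamily f).IsSet := trivial

theorem ext {x y : ZFA.{u} A} (hx : x.IsSet) (hy : y.IsSet) (h : ∀ z, z ∈ x ↔ z ∈ y) :
    x = y := by
  induction x using Quotient.inductionOn with
  | h x =>
  induction y using Quotient.inductionOn with
  | h y =>
  cases x with
  | atom a => exact hx.elim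
  | mk ι f =>
  cases y with
  | atom a => exact hy.elim
  | mk κ g =>
  refine Quotient.sound ?_
  change PreZFA.Equiv _ _
  simp only [PreZFA.Equiv]
  refine ⟨fun i => ?_, fun k => ?_⟩
  · exact (h (Quotient.mk _ (f i))).1 ⟨i, PreZFA.Equiv.refl _⟩
  · obtain ⟨i, hi⟩ := (h (Quotient.mk _ (g k))).2 ⟨k, PreZFA.Equiv.refl _⟩
    exact ⟨i, hi.symm⟩

theorem smul_mem_smul (π : Equiv.Perm A) {x y : ZFA.{u} A} (h : y ∈ x) : π • y ∈ π • x := by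
  induction x using Quotient.inductionOn with
  | h x =>
  induction y using Quotient.inductionOn with
  | h y =>
  cases x with
  | atom a => exact h.elim
  | mk ι f =>
  obtain ⟨i, hi⟩ := h
  exact ⟨i, PreZFA.permute_congr π hi⟩

theorem isSet_smul (π : Equiv.Perm A) {x : ZFA.{u} A} : (π • x).IsSet ↔ x.IsSet := by
  induction x using Quotient.inductionOn with
  | h x => cases x <;> exact Iff.rfl

theorem smul_atom (π : Equiv.Perm A) (a : A) : π • (atom a : ZFA.{u} A) = atom (π a) := rfl

theorem atom_injective : Function.Injective (atom : A → ZFA.{u} A) := by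
  intro a b h
  have h' : PreZFA.Equiv (PreZFA.atom a) (PreZFA.atom b) := Quotient.exact h
  simpa only [PreZFA.Equiv] using h'

theorem not_isSet_atom (a : A) : ¬ (atom a : ZFA.{u} A).IsSet := fun h => h

theorem notMem_atom (a : A) (z : ZFA.{u} A) : z ∉ (atom a : ZFA.{u} A) := by
  induction z using Quotient.inductionOn with
  | h z => exact fun h => h

/-- Sets are formed from families indexed by `Type u`, so a collection can become a set only if it
is `u`-small. Subcollections of a set are. -/
theorem small_setOf_mem (x : ZFA.{u} A) : Small.{u} {z | z ∈ x} := by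
  induction x using Quotient.inductionOn with
  | h x =>
  cases x with
  | atom a =>
    have : {z | z ∈ (atom a : ZFA.{u} A)} = ∅ := by
      ext z
      simp [notMem_atom]
    change Small.{u} {z | z ∈ (atom a : ZFA.{u} A)}
    rw [this]
    infer_instance
  | mk ι f =>
    refine small_subset (s := Set.range fun i => (Quotient.mk _ (f i) : ZFA.{u} A)) ?_
    intro z
    induction z using Quotient.inductionOn with
    | h z =>
    rintro ⟨i, hi⟩
    exact ⟨i, Quotient.sound hi.symm⟩

/-- Conjugation by `π` turns permutations fixing `π E` into permutations fixing `E`, so the image of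
a support supports the image; the rest is induction along membership. -/
theorem HereditarilySymmetric.smul {G : Subgroup (Equiv.Perm A)} {x : ZFA.{u} A}
    (hx : HereditarilySymmetric G x) {π : Equiv.Perm A} (hπ : π ∈ G) :
    HereditarilySymmetric G (π • x) := by
  induction hx with
  | intro x hE _ ih =>
    obtain ⟨E, hE⟩ := hE
    refine ⟨_, ⟨E.map π.toEmbedding, fun σ hσ hσE => ?_⟩, fun y hy => ?_⟩
    · have h := hE (π⁻¹ * σ * π) (mul_mem (mul_mem (inv_mem hπ) hσ) hπ) fun a ha => by
        have := hσE (π a) (Finset.mem_map_of_mem _ ha)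
        simp [this]
      rwa [mul_smul, mul_smul, inv_smul_eq_iff] at h
    · have h := smul_mem_smul π⁻¹ hy
      rw [inv_smul_smul] at h
      have h' := ih _ h
      rwa [smul_inv_smul] at h'

end ZFA

/-! ### Sets, relations and functions inside a permutation model -/

namespace PermutationModel

open SetStructure

variable {A : Type} {G : Subgroup (Equiv.Perm A)}

instance : MulAction G (PermutationModel.{u} G) where
  smul π x := ⟨(π : Equiv.Perm A) • x.1, x.2.smul π.2⟩
  one_smul x := Subtype.ext (one_smul _ x.1)
  mul_smul π σ x := Subtype.ext (mul_smul (π : Equiv.Perm A) σ x.1)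

theorem val_smul (π : G) (x : PermutationModel.{u} G) :
    (π • x).1 = (π : Equiv.Perm A) • x.1 := rfl

/-- The elements of an element of the model. -/
def elements (x : PermutationModel.{u} G) : Set (PermutationModel.{u} G) := {z | z ∈ x}

theorem mem_elements {x z : PermutationModel.{u} G} : z ∈ x.elements ↔ z ∈ x := Iff.rfl

theorem ext {x y : PermutationModel.{u} G} (hx : IsSet x) (hy : IsSet y)
    (h : ∀ z, z ∈ x ↔ z ∈ y) : x = y := by
  refine Subtype.ext (ZFA.ext hx hy fun z => ⟨fun hz => ?_, fun hz => ?_⟩)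
  · cases x.2 with
    | intro _ _ h' => exact (h ⟨z, h' z hz⟩).1 hz
  · cases y.2 with
    | intro _ _ h' => exact (h ⟨z, h' z hz⟩).2 hz

theorem smul_mem_smul (π : G) {x z : PermutationModel.{u} G} (h : z ∈ x) : π • z ∈ π • x :=
  ZFA.smul_mem_smul (π : Equiv.Perm A) h

theorem smul_mem_smul_iff (π : G) {x z : PermutationModel.{u} G} : π • z ∈ π • x ↔ z ∈ x :=
  ⟨fun h => by simpa using smul_mem_smul π⁻¹ h, smul_mem_smul π⟩

theorem mem_smul_iff (π : G) {x z : PermutationModel.{u} G} : z ∈ π • x ↔ π⁻¹ • z ∈ x := by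
  rw [← smul_mem_smul_iff π (x := x), smul_inv_smul]

theorem isSet_smul (π : G) {x : PermutationModel.{u} G} : IsSet (π • x) ↔ IsSet x :=
  ZFA.isSet_smul _

/-- The permutations in `G` that fix the points of `E`. -/
def fixing (G : Subgroup (Equiv.Perm A)) (E : Finset A) : Subgroup G where
  carrier := {π | ∀ a ∈ E, (π : Equiv.Perm A) a = a}
  one_mem' _ _ := rfl
  mul_mem' {π σ} hπ hσ a ha := by
    change (π : Equiv.Perm A) ((σ : Equiv.Perm A) a) = a
    rw [hσ a ha, hπ a ha]
  inv_mem' {π} hπ a ha := by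
    change (π : Equiv.Perm A)⁻¹ a = a
    rw [Equiv.Perm.inv_eq_iff_eq, hπ a ha]

theorem fixing_anti {E E' : Finset A} (h : E ⊆ E') : fixing G E' ≤ fixing G E :=
  fun _ hπ a ha => hπ a (h ha)

/-- `E` is a support of `x`. -/
def Supports (E : Finset A) (x : PermutationModel.{u} G) : Prop := ∀ π ∈ fixing G E, π • x = x

theorem Supports.mono {E E' : Finset A} {x : PermutationModel.{u} G} (hx : Supports E x)
    (h : E ⊆ E') : Supports E' x := fun π hπ => hx π (fixing_anti h hπ)

theorem exists_supports (x : PermutationModel.{u} G) : ∃ E, Supports E x := by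
  cases x.2 with
  | intro _ h _ =>
    obtain ⟨E, hE⟩ := h
    exact ⟨E, fun π hπ => Subtype.ext (hE π π.2 hπ)⟩

theorem exists_supports_of_finite {K : Set (PermutationModel.{u} G)} (hK : K.Finite) :
    ∃ E : Finset A, ∀ x ∈ K, Supports E x := by
  classical
  choose E hE using exists_supports (G := G)
  exact ⟨hK.toFinset.biUnion E, fun x hx => (hE x).mono
    (Finset.subset_biUnion_of_mem E (hK.mem_toFinset.2 hx))⟩

instance small_elements (x : PermutationModel.{u} G) : Small.{u} x.elements := by
  have := ZFA.small_setOf_mem x.1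
  exact small_of_injective (β := {z | z ∈ x.1}) (f := fun z => ⟨z.1.1, z.2⟩) fun z w h => by
    have h' := congrArg (fun v => v.1) h
    exact Subtype.ext (Subtype.ext h')

theorem small_subsets (x : PermutationModel.{u} G) : Small.{u} {z | IsSubset z x} := by
  refine small_of_injective (β := Set x.elements) (f := fun z => {w | w.1 ∈ z.1}) ?_
  intro z w h
  refine Subtype.ext (ext z.2.1 w.2.1 fun v => ⟨fun hv => ?_, fun hv => ?_⟩)
  · exact (Set.ext_iff.1 h ⟨v, z.2.2 v hv⟩).1 hv
  · exact (Set.ext_iff.1 h ⟨v, w.2.2 v hv⟩).2 hv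

/-- A small collection of elements of the model is a set of the model if it has a finite
support. -/
theorem exists_elements_eq (K : Set (PermutationModel.{u} G)) [Small.{u} K] (E : Finset A)
    (hE : ∀ π ∈ fixing G E, ∀ z ∈ K, π • z ∈ K) :
    ∃ x : PermutationModel.{u} G, IsSet x ∧ Supports E x ∧ x.elements = K := by
  let y : ZFA.{u} A := ZFA.ofFamily fun i : Shrink.{u} K => ((equivShrink K).symm i).1.1
  have hy : ∀ z, z ∈ y ↔ ∃ w ∈ K, z = w.1 := by
    intro z
    rw [ZFA.mem_ofFamily]
    constructor
    · rintro ⟨i, rfl⟩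
      exact ⟨_, ((equivShrink K).symm i).2, rfl⟩
    · rintro ⟨w, hw, rfl⟩
      exact ⟨equivShrink K ⟨w, hw⟩, by simp⟩
  have hsmul : ∀ π ∈ fixing G E, (π : Equiv.Perm A) • y = y := by
    intro π hπ
    refine ZFA.ext ((ZFA.isSet_smul _).2 (ZFA.isSet_ofFamily _)) (ZFA.isSet_ofFamily _)
      fun z => ⟨fun hz => ?_, fun hz => ?_⟩
    · have h := ZFA.smul_mem_smul (π : Equiv.Perm A)⁻¹ hz
      rw [inv_smul_smul, hy] at h
      obtain ⟨w, hw, h⟩ := h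
      rw [inv_smul_eq_iff] at h
      exact (hy z).2 ⟨π • w, hE π hπ w hw, h⟩
    · obtain ⟨w, hw, rfl⟩ := (hy z).1 hz
      have h := ZFA.smul_mem_smul (π : Equiv.Perm A)
        ((hy _).2 ⟨π⁻¹ • w, hE _ (inv_mem hπ) w hw, rfl⟩)
      rwa [← val_smul, smul_inv_smul] at h
  have hsym : ZFA.HereditarilySymmetric G y := by
    refine ⟨y, ⟨E, fun π hπ hπE => hsmul ⟨π, hπ⟩ hπE⟩, fun z hz => ?_⟩
    obtain ⟨w, -, rfl⟩ := (hy z).1 hz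
    exact w.2
  refine ⟨⟨y, hsym⟩, ZFA.isSet_ofFamily _, fun π hπ => Subtype.ext (hsmul π hπ), ?_⟩
  ext z
  refine (hy z.1).trans ⟨?_, fun h => ⟨z, h, rfl⟩⟩
  rintro ⟨w, hw, h⟩
  rwa [Subtype.ext h]

/-- The union of supports of the finitely many elements fixes each of them, hence also their set. -/
theorem exists_elements_eq_of_finite {K : Set (PermutationModel.{u} G)} (hK : K.Finite) :
    ∃ x : PermutationModel.{u} G, IsSet x ∧ x.elements = K := by
  have := hK.to_subtype
  obtain ⟨E, hE⟩ := exists_supports_of_finite hK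
  obtain ⟨x, hx, -, h⟩ := exists_elements_eq K E fun π hπ z hz => by rwa [hE z hz π hπ]
  exact ⟨x, hx, h⟩

theorem exists_isUnorderedPair (a b : PermutationModel.{u} G) : ∃ z, IsUnorderedPair z a b := by
  obtain ⟨z, hz, h⟩ := exists_elements_eq_of_finite (Set.toFinite {a, b})
  exact ⟨z, hz, fun w => Set.ext_iff.1 h w⟩

theorem exists_isPair (a b : PermutationModel.{u} G) : ∃ p, IsPair p a b := by
  obtain ⟨s, hs⟩ := exists_isUnorderedPair a a
  obtain ⟨t, ht⟩ := exists_isUnorderedPair a b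
  obtain ⟨p, hp⟩ := exists_isUnorderedPair s t
  refine ⟨p, hp.1, fun z => (hp.2 z).trans (or_congr ?_ ?_)⟩
  · exact ⟨fun h => h ▸ hs, fun h => ext h.1 hs.1 fun w => (h.2 w).trans (hs.2 w).symm⟩
  · exact ⟨fun h => h ▸ ht, fun h => ext h.1 ht.1 fun w => (h.2 w).trans (ht.2 w).symm⟩

/-- The ordered pair. -/
noncomputable def pair (a b : PermutationModel.{u} G) : PermutationModel.{u} G :=
  (exists_isPair a b).choose

theorem isPair_iff {p a b : PermutationModel.{u} G} : IsPair p a b ↔ p = pair a b := by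
  have h := (exists_isPair a b).choose_spec
  refine ⟨fun hp => ext hp.1 h.1 fun z => (hp.2 z).trans (h.2 z).symm, ?_⟩
  rintro rfl
  exact h

theorem pair_inj {a b a' b' : PermutationModel.{u} G} (h : pair a b = pair a' b') :
    a = a' ∧ b = b' := by
  have h1 := isPair_iff.2 (rfl : pair a b = _)
  have h2 := isPair_iff.2 h
  have key : ∀ z, (IsUnorderedPair z a a ∨ IsUnorderedPair z a b) ↔
      (IsUnorderedPair z a' a' ∨ IsUnorderedPair z a' b') :=
    fun z => (h1.2 z).symm.trans (h2.2 z)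
  have hsub : ∀ {z c d c' d' : PermutationModel.{u} G}, IsUnorderedPair z c d →
      IsUnorderedPair z c' d' → ∀ w, (w = c ∨ w = d) ↔ (w = c' ∨ w = d') :=
    fun hz hz' w => (hz.2 w).symm.trans (hz'.2 w)
  obtain ⟨s, hs⟩ := exists_isUnorderedPair a a
  obtain ⟨t, ht⟩ := exists_isUnorderedPair a b
  obtain ⟨t', ht'⟩ := exists_isUnorderedPair a' b'
  have ha : a = a' := by
    rcases (key s).1 (.inl hs) with h | h
    · exact ((hsub hs h a').2 (.inl rfl)).elim Eq.symm Eq.symm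
    · exact ((hsub hs h a').2 (.inl rfl)).elim Eq.symm Eq.symm
  subst ha
  refine ⟨rfl, ?_⟩
  have hb : b = a ∨ b = b' := by
    rcases (key t).1 (.inr ht) with h | h
    · exact .inl (((hsub ht h b).1 (.inr rfl)).elim _root_.id _root_.id)
    · exact (hsub ht h b).1 (.inr rfl)
  have hb' : b' = a ∨ b' = b := by
    rcases (key t').2 (.inr ht') with h | h
    · exact .inl (((hsub ht' h b').1 (.inr rfl)).elim _root_.id _root_.id)
    · exact (hsub ht' h b').1 (.inr rfl)
  grind

theorem smul_pair (π : G) (a b : PermutationModel.{u} G) :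
    π • pair a b = pair (π • a) (π • b) := by
  have hup : ∀ {z c d : PermutationModel.{u} G} (σ : G), IsUnorderedPair z c d →
      IsUnorderedPair (σ • z) (σ • c) (σ • d) := by
    rintro z c d σ ⟨hz, h⟩
    refine ⟨(isSet_smul σ).2 hz, fun w => ?_⟩
    rw [mem_smul_iff, h, inv_smul_eq_iff, inv_smul_eq_iff]
  have hup' : ∀ {z c d : PermutationModel.{u} G}, IsUnorderedPair (π⁻¹ • z) c d ↔
      IsUnorderedPair z (π • c) (π • d) := fun {z c d} =>
    ⟨fun h => by simpa using hup π h, fun h => by simpa using hup π⁻¹ h⟩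
  obtain ⟨h1, h2⟩ := isPair_iff.2 (rfl : pair a b = _)
  refine isPair_iff.1 ⟨(isSet_smul π).2 h1, fun z => ?_⟩
  rw [mem_smul_iff, h2, hup', hup']

theorem related_iff {r a b : PermutationModel.{u} G} : Related r a b ↔ pair a b ∈ r := by
  simp [Related, isPair_iff]

/-- Relations with a finite support are available in the model. -/
theorem exists_relation (x y : PermutationModel.{u} G)
    (R : PermutationModel.{u} G → PermutationModel.{u} G → Prop) (E : Finset A)
    (hx : Supports E x) (hy : Supports E y)
    (hR : ∀ π ∈ fixing G E, ∀ a ∈ x, ∀ b ∈ y, R a b → R (π • a) (π • b)) :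
    ∃ r : PermutationModel.{u} G, IsSet r ∧
      (∀ p, p ∈ r → ∃ a b, a ∈ x ∧ b ∈ y ∧ IsPair p a b) ∧
      ∀ a b, Related r a b ↔ a ∈ x ∧ b ∈ y ∧ R a b := by
  let K : Set (PermutationModel.{u} G) := {p | ∃ a ∈ x, ∃ b ∈ y, R a b ∧ p = pair a b}
  have : Small.{u} K := by
    refine small_subset (s := Set.range fun q : x.elements × y.elements => pair q.1.1 q.2.1) ?_
    rintro _ ⟨a, ha, b, hb, -, rfl⟩
    exact ⟨⟨⟨a, ha⟩, ⟨b, hb⟩⟩, rfl⟩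
  obtain ⟨r, hr, -, h⟩ := exists_elements_eq K E (by
    rintro π hπ _ ⟨a, ha, b, hb, hab, rfl⟩
    refine ⟨π • a, ?_, π • b, ?_, hR π hπ a ha b hb hab, smul_pair π a b⟩
    · have := smul_mem_smul π ha
      rwa [hx π hπ] at this
    · have := smul_mem_smul π hb
      rwa [hy π hπ] at this)
  refine ⟨r, hr, fun p hp => ?_, fun a b => ?_⟩
  · obtain ⟨a, ha, b, hb, -, h'⟩ := (Set.ext_iff.1 h p).1 hp
    exact ⟨a, b, ha, hb, isPair_iff.2 h'⟩
  · rw [related_iff]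
    refine (Set.ext_iff.1 h _).trans ⟨?_, fun ⟨ha, hb, hab⟩ => ⟨a, ha, b, hb, hab, rfl⟩⟩
    rintro ⟨a', ha, b', hb, hab, h'⟩
    obtain ⟨rfl, rfl⟩ := pair_inj h'
    exact ⟨ha, hb, hab⟩

theorem exists_isFunction {x y : PermutationModel.{u} G}
    {R : PermutationModel.{u} G → PermutationModel.{u} G → Prop} {E : Finset A}
    (hx : Supports E x) (hy : Supports E y)
    (hR : ∀ π ∈ fixing G E, ∀ a ∈ x, ∀ b ∈ y, R a b → R (π • a) (π • b))
    (h : ∀ a ∈ x, ∃! b, b ∈ y ∧ R a b) :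
    ∃ f : PermutationModel.{u} G, IsFunction f x y ∧
      ∀ a b, Related f a b ↔ a ∈ x ∧ b ∈ y ∧ R a b := by
  obtain ⟨f, hf, hp, hrel⟩ := exists_relation x y R E hx hy hR
  refine ⟨f, ⟨hf, hp, fun a ha => ?_⟩, hrel⟩
  simpa [hrel, ha] using h a ha

theorem exists_isBijection {x y : PermutationModel.{u} G}
    {R : PermutationModel.{u} G → PermutationModel.{u} G → Prop} {E : Finset A}
    (hx : Supports E x) (hy : Supports E y)
    (hR : ∀ π ∈ fixing G E, ∀ a ∈ x, ∀ b ∈ y, R a b → R (π • a) (π • b))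
    (h : ∀ a ∈ x, ∃! b, b ∈ y ∧ R a b) (h' : ∀ b ∈ y, ∃! a, a ∈ x ∧ R a b) :
    ∃ f : PermutationModel.{u} G, IsBijection f x y := by
  obtain ⟨f, hf, hrel⟩ := exists_isFunction hx hy hR h
  refine ⟨f, hf, fun b hb => ?_⟩
  simpa [hrel, hb] using h' b hb

theorem supports_of_elements {E : Finset A} {x : PermutationModel.{u} G} (hx : IsSet x)
    (h : ∀ z ∈ x, Supports E z) : Supports E x := by
  intro π hπ
  refine ext ((isSet_smul π).2 hx) hx fun z => ?_
  rw [mem_smul_iff]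
  constructor
  · intro hz
    have := h _ hz π hπ
    rw [smul_inv_smul] at this
    rwa [← this] at hz
  · intro hz
    rwa [h z hz _ (inv_mem hπ)]

/-- Permutations fixing `E` fix every element on both sides, so any external bijection is invariant
and its graph lies in the model. -/
theorem exists_isBijection_of_equiv {x y : PermutationModel.{u} G} {E : Finset A} (hx : IsSet x)
    (hy : IsSet y) (hxE : ∀ z ∈ x, Supports E z) (hyE : ∀ z ∈ y, Supports E z)
    (e : x.elements ≃ y.elements) : ∃ f : PermutationModel.{u} G, IsBijection f x y := by
  refine exists_isBijection (R := fun a b => ∃ ha : a ∈ x, (e ⟨a, ha⟩ : PermutationModel.{u} G) = b)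
    (supports_of_elements hx hxE) (supports_of_elements hy hyE) ?_ ?_ ?_
  · intro π hπ a ha b hb h
    rwa [hxE a ha π hπ, hyE b hb π hπ]
  · intro a ha
    exact ⟨e ⟨a, ha⟩, ⟨(e ⟨a, ha⟩).2, ha, rfl⟩, fun b hb => hb.2.2.symm⟩
  · intro b hb
    refine ⟨e.symm ⟨b, hb⟩, ⟨(e.symm ⟨b, hb⟩).2, (e.symm ⟨b, hb⟩).2,
      congrArg Subtype.val (e.apply_symm_apply ⟨b, hb⟩)⟩, ?_⟩
    rintro a ⟨-, ha, rfl⟩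
    exact (congrArg Subtype.val (e.symm_apply_apply ⟨a, ha⟩)).symm

theorem nonempty_equiv_of_isBijection {f x y : PermutationModel.{u} G} (h : IsBijection f x y) :
    Nonempty (x.elements ≃ y.elements) := by
  obtain ⟨⟨-, hp, hf⟩, hf'⟩ := h
  have hmem : ∀ a b, Related f a b → a ∈ x ∧ b ∈ y := by
    intro a b hab
    obtain ⟨a', b', ha, hb, h'⟩ := hp _ (related_iff.1 hab)
    obtain ⟨rfl, rfl⟩ := pair_inj (isPair_iff.1 h')
    exact ⟨ha, hb⟩
  choose φ hφ hφ' using hf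
  choose ψ hψ hψ' using hf'
  exact ⟨⟨fun a => ⟨φ a a.2, (hmem _ _ (hφ a a.2)).2⟩, fun b => ⟨ψ b b.2, (hmem _ _ (hψ b b.2)).1⟩,
    fun a => Subtype.ext (hψ' _ (hmem _ _ (hφ a a.2)).2 _ (hφ a a.2)).symm,
    fun b => Subtype.ext (hφ' _ (hmem _ _ (hψ b b.2)).1 _ (hψ b b.2)).symm⟩⟩

end PermutationModel

/-! ### Natural numbers and finiteness inside the model -/

namespace PermutationModel

open SetStructure

variable {A : Type} {G : Subgroup (Equiv.Perm A)}

theorem elements_injOn {x y : PermutationModel.{u} G} (hx : IsSet x) (hy : IsSet y)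
    (h : x.elements = y.elements) : x = y := ext hx hy fun z => Set.ext_iff.1 h z

theorem exists_isSuccessor (x : PermutationModel.{u} G) : ∃ y, IsSuccessor y x := by
  obtain ⟨E, hE⟩ := exists_supports x
  have : Small.{u} ↑(x.elements ∪ {x}) := inferInstance
  obtain ⟨y, hy, -, h⟩ := exists_elements_eq (x.elements ∪ {x}) E (by
    rintro π hπ z (hz | rfl)
    · refine .inl ?_
      have := smul_mem_smul π (mem_elements.1 hz)
      rwa [hE π hπ] at this
    · exact .inr (hE π hπ))
  exact ⟨y, hy, fun z => Set.ext_iff.1 h z⟩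

theorem exists_isEmptySet (G : Subgroup (Equiv.Perm A)) :
    ∃ x : PermutationModel.{u} G, IsEmptySet x := by
  obtain ⟨x, hx, h⟩ := exists_elements_eq_of_finite (G := G) Set.finite_empty
  exact ⟨x, hx, fun z => (Set.ext_iff.1 h z).not.2 (Set.notMem_empty z)⟩

/-- The von Neumann numerals. -/
noncomputable def numeral (G : Subgroup (Equiv.Perm A)) : ℕ → PermutationModel.{u} G
  | 0 => (exists_isEmptySet G).choose
  | k + 1 => (exists_isSuccessor (numeral G k)).choose

theorem isEmptySet_numeral_zero : IsEmptySet (numeral.{u} G 0) :=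
  (exists_isEmptySet G).choose_spec

theorem isSuccessor_numeral (k : ℕ) : IsSuccessor (numeral.{u} G (k + 1)) (numeral G k) :=
  (exists_isSuccessor (numeral G k)).choose_spec

theorem isSet_numeral (k : ℕ) : IsSet (numeral.{u} G k) := by
  cases k with
  | zero => exact isEmptySet_numeral_zero.1
  | succ k => exact (isSuccessor_numeral k).1

theorem mem_numeral {k : ℕ} {z : PermutationModel.{u} G} :
    z ∈ numeral G k ↔ ∃ j < k, z = numeral G j := by
  induction k with
  | zero => simp [isEmptySet_numeral_zero.2 z]
  | succ k ih =>
    rw [(isSuccessor_numeral k).2, ih]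
    constructor
    · rintro (⟨j, hj, rfl⟩ | rfl)
      exacts [⟨j, by omega, rfl⟩, ⟨k, by omega, rfl⟩]
    · rintro ⟨j, hj, rfl⟩
      rcases Nat.lt_succ_iff_lt_or_eq.1 hj with h | rfl
      exacts [.inl ⟨j, h, rfl⟩, .inr rfl]

theorem numeral_notMem_self (k : ℕ) : numeral.{u} G k ∉ numeral G k := by
  induction k with
  | zero => exact isEmptySet_numeral_zero.2 _
  | succ k ih =>
    intro h
    obtain ⟨j, hj, h⟩ := mem_numeral.1 h
    apply ih
    -- If the numeral of `k + 1` were that of some `j ≤ k`, the numeral of `k` would be a smaller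
    -- numeral and thus an element of itself.
    have h1 : numeral.{u} G k ∈ numeral G (k + 1) := mem_numeral.2 ⟨k, by omega, rfl⟩
    rw [h] at h1
    obtain ⟨i, hi, h1⟩ := mem_numeral.1 h1
    exact mem_numeral.2 ⟨i, by omega, h1⟩

theorem numeral_injective : Function.Injective (numeral.{u} G) := by
  have : ∀ i j, i < j → numeral.{u} G i ≠ numeral G j := fun i j hij h =>
    numeral_notMem_self j (mem_numeral.2 ⟨i, hij, h.symm⟩)
  intro i j h
  rcases lt_trichotomy i j with hij | hij | hij
  exacts [absurd h (this i j hij), hij, absurd h.symm (this j i hij)]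

theorem elements_numeral (k : ℕ) : (numeral.{u} G k).elements = numeral G '' Set.Iio k := by
  ext z
  rw [mem_elements, mem_numeral]
  simp [eq_comm]

theorem finite_elements_numeral (k : ℕ) : (numeral.{u} G k).elements.Finite := by
  rw [elements_numeral]
  exact (Set.finite_Iio k).image _

theorem ncard_elements_numeral (k : ℕ) : (numeral.{u} G k).elements.ncard = k := by
  rw [elements_numeral, Set.ncard_image_of_injective _ numeral_injective]
  simp

theorem smul_numeral (π : G) (k : ℕ) : π • numeral.{u} G k = numeral G k := by
  induction k using Nat.strong_induction_on with
  | _ k ih =>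
    refine ext ((isSet_smul π).2 (isSet_numeral k)) (isSet_numeral k) fun z => ?_
    rw [mem_smul_iff, mem_numeral, mem_numeral]
    refine exists_congr fun j => and_congr_right fun hj => ?_
    rw [inv_smul_eq_iff, ih j hj]

theorem isNumeral_iff {k : ℕ} {x : PermutationModel.{u} G} : IsNumeral k x ↔ x = numeral G k := by
  induction k generalizing x with
  | zero =>
    have h := isEmptySet_numeral_zero (G := G)
    refine ⟨fun hx => ext hx.1 h.1 fun z => iff_of_false (hx.2 z) (h.2 z), ?_⟩
    rintro rfl
    exact h
  | succ k ih =>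
    have h := isSuccessor_numeral (G := G) k
    constructor
    · rintro ⟨j, hj, hx⟩
      obtain rfl := ih.1 hj
      exact ext hx.1 h.1 fun z => (hx.2 z).trans (h.2 z).symm
    · rintro rfl
      exact ⟨_, ih.2 rfl, h⟩

/-- Every permutation fixes every numeral, so the set of numerals lies in the model with empty
support. It is inductive there and therefore contains all internal natural numbers. -/
theorem isNatural_iff {x : PermutationModel.{u} G} : IsNatural x ↔ ∃ k, x = numeral G k := by
  constructor
  · intro hx
    obtain ⟨I, hI, -, h⟩ := exists_elements_eq (Set.range (numeral.{u} G)) ∅ (by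
      rintro π - _ ⟨k, rfl⟩
      exact ⟨k, (smul_numeral π k).symm⟩)
    have hI' : ∀ z, z ∈ I ↔ ∃ k, numeral G k = z := fun z => Set.ext_iff.1 h z
    obtain ⟨k, hk⟩ := (hI' x).1 (hx I ⟨hI, fun e he => (hI' e).2 ⟨0, ((isNumeral_iff (k := 0)).1 he).symm⟩, by
      intro z hz y hy
      obtain ⟨k, rfl⟩ := (hI' z).1 hz
      exact (hI' y).2 ⟨k + 1, ((isNumeral_iff (k := k + 1)).1
        ⟨_, isNumeral_iff.2 rfl, hy⟩).symm⟩⟩)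
    exact ⟨k, hk.symm⟩
  · rintro ⟨k, rfl⟩ I ⟨-, h0, hs⟩
    induction k with
    | zero => exact h0 _ isEmptySet_numeral_zero
    | succ k ih => exact hs _ ih _ (isSuccessor_numeral k)

/-- Internal and external finiteness agree: finitely many elements have a common finite support, and
this puts an external enumeration into the model. -/
theorem exists_isBijection_numeral_iff {x : PermutationModel.{u} G} (hx : IsSet x) {k : ℕ} :
    (∃ f, IsBijection f (numeral G k) x) ↔ x.elements.Finite ∧ x.elements.ncard = k := by
  constructor
  · rintro ⟨f, hf⟩
    obtain ⟨e⟩ := nonempty_equiv_of_isBijection hf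
    have := (finite_elements_numeral (G := G) k).to_subtype
    refine ⟨Set.finite_coe_iff.1 (Finite.of_equiv _ e), ?_⟩
    rw [← ncard_elements_numeral (G := G) k]
    exact (Nat.card_congr e).symm
  · rintro ⟨hfin, hk⟩
    have := hfin.to_subtype
    have := (finite_elements_numeral (G := G) k).to_subtype
    obtain ⟨E, hE⟩ := exists_supports_of_finite hfin
    have e : (numeral G k).elements ≃ x.elements := Classical.choice (Finite.card_eq.1
      ((ncard_elements_numeral (G := G) k).trans hk.symm))
    refine exists_isBijection_of_equiv (E := E) (isSet_numeral k) hx (fun z hz π _ => ?_) hE e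
    obtain ⟨j, -, rfl⟩ := mem_numeral.1 hz
    exact smul_numeral π j

theorem isFiniteSet_iff {x : PermutationModel.{u} G} :
    IsFiniteSet x ↔ IsSet x ∧ x.elements.Finite := by
  refine and_congr_right fun hx => ⟨?_, fun h => ?_⟩
  · rintro ⟨k, f, hk, hf⟩
    obtain ⟨k, rfl⟩ := isNatural_iff.1 hk
    exact ((exists_isBijection_numeral_iff hx).1 ⟨f, hf⟩).1
  · obtain ⟨f, hf⟩ := (exists_isBijection_numeral_iff hx).2 ⟨h, rfl⟩
    exact ⟨_, f, isNatural_iff.2 ⟨_, rfl⟩, hf⟩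

theorem isInfiniteSet_iff {x : PermutationModel.{u} G} :
    IsInfiniteSet x ↔ IsSet x ∧ x.elements.Infinite := by
  refine and_congr_right fun hx => ?_
  rw [isFiniteSet_iff, not_and, imp_iff_right hx]
  rfl

theorem hasCard_iff {n : ℕ} {x : PermutationModel.{u} G} :
    HasCard n x ↔ IsSet x ∧ x.elements.Finite ∧ x.elements.ncard = n := by
  refine and_congr_right fun hx => ?_
  rw [← exists_isBijection_numeral_iff hx]
  simp [isNumeral_iff]

theorem hasFiniteCardGT_iff {n : ℕ} {x : PermutationModel.{u} G} :
    HasFiniteCardGT n x ↔ IsSet x ∧ x.elements.Finite ∧ n < x.elements.ncard := by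
  refine and_congr_right fun hx => ⟨?_, fun h => ?_⟩
  · rintro ⟨m, k, f, hm, hk, hmk, hf⟩
    obtain rfl := isNumeral_iff.1 hm
    obtain ⟨k, rfl⟩ := isNatural_iff.1 hk
    obtain ⟨h1, h2⟩ := (exists_isBijection_numeral_iff hx).1 ⟨f, hf⟩
    obtain ⟨j, hj, h⟩ := mem_numeral.1 hmk
    rw [numeral_injective h, h2]
    exact ⟨h1, hj⟩
  · obtain ⟨f, hf⟩ := (exists_isBijection_numeral_iff hx).2 ⟨h.1, rfl⟩
    exact ⟨_, _, f, isNumeral_iff.2 rfl, isNatural_iff.2 ⟨_, rfl⟩,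
      mem_numeral.2 ⟨n, h.2, rfl⟩, hf⟩

theorem elements_smul (π : G) (x : PermutationModel.{u} G) :
    (π • x).elements = (fun z => π • z) '' x.elements := by
  ext z
  rw [mem_elements, mem_smul_iff]
  exact ⟨fun h => ⟨_, h, smul_inv_smul π z⟩, by rintro ⟨w, hw, rfl⟩; simpa [mem_elements] using hw⟩

theorem isSubset_smul {x y : PermutationModel.{u} G} {π : G} (h : IsSubset x y)
    (hy : π • y = y) : IsSubset (π • x) y := by
  refine ⟨(isSet_smul π).2 h.1, fun z hz => ?_⟩
  rw [← hy, mem_smul_iff]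
  exact h.2 _ ((mem_smul_iff π).1 hz)

theorem exists_isSubsetsOfCard (n : ℕ) {y : PermutationModel.{u} G} {E : Finset A}
    (hy : Supports E y) : ∃ Q, IsSubsetsOfCard n Q y ∧ Supports E Q := by
  have : Small.{u} {z | IsSubset z y ∧ HasCard n z} :=
    @small_subset _ _ _ (fun z hz => hz.1) (small_subsets y)
  obtain ⟨Q, hQ, hE, h⟩ := exists_elements_eq {z | IsSubset z y ∧ HasCard n z} E (by
    rintro π hπ z ⟨h1, h2⟩
    refine ⟨isSubset_smul h1 (hy π hπ), ?_⟩
    rw [hasCard_iff] at h2 ⊢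
    rw [elements_smul, Set.ncard_image_of_injective _ (MulAction.injective π)]
    exact ⟨(isSet_smul π).2 h2.1, h2.2.1.image _, h2.2.2⟩)
  exact ⟨Q, ⟨hQ, fun z => Set.ext_iff.1 h z⟩, hE⟩

theorem exists_isFiniteSubsetsOfCardGT (n : ℕ) {y : PermutationModel.{u} G} {E : Finset A}
    (hy : Supports E y) : ∃ P, IsFiniteSubsetsOfCardGT n P y ∧ Supports E P := by
  have : Small.{u} {z | IsSubset z y ∧ HasFiniteCardGT n z} :=
    @small_subset _ _ _ (fun z hz => hz.1) (small_subsets y)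
  obtain ⟨Q, hQ, hE, h⟩ := exists_elements_eq {z | IsSubset z y ∧ HasFiniteCardGT n z} E (by
    rintro π hπ z ⟨h1, h2⟩
    refine ⟨isSubset_smul h1 (hy π hπ), ?_⟩
    rw [hasFiniteCardGT_iff] at h2 ⊢
    rw [elements_smul, Set.ncard_image_of_injective _ (MulAction.injective π)]
    exact ⟨(isSet_smul π).2 h2.1, h2.2.1.image _, h2.2.2⟩)
  exact ⟨Q, ⟨hQ, fun z => Set.ext_iff.1 h z⟩, hE⟩

/-! ### Selections and well-orderings inside the model -/

/-- A selection `[y]^{>n} → [y]^n` given by a relation that is invariant under the permutations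
fixing `E`. -/
theorem exists_selection {n : ℕ} {y : PermutationModel.{u} G} {E : Finset A} (hy : Supports E y)
    (R : PermutationModel.{u} G → PermutationModel.{u} G → Prop)
    (hR : ∀ π ∈ fixing G E, ∀ z w, IsSubset z y → IsSubset w y → R z w → R (π • z) (π • w))
    (h : ∀ z, IsSubset z y → z.elements.Finite → n < z.elements.ncard →
      ∃! w, IsSubset w z ∧ w.elements.ncard = n ∧ R z w)
    (hsub : ∀ z w, R z w → IsSubset w z) :
    ∃ P Q f, IsFiniteSubsetsOfCardGT n P y ∧ IsSubsetsOfCard n Q y ∧ IsFunction f P Q ∧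
      ∀ z w, Related f z w → IsSubset w z := by
  obtain ⟨P, hP, hPE⟩ := exists_isFiniteSubsetsOfCardGT n hy
  obtain ⟨Q, hQ, hQE⟩ := exists_isSubsetsOfCard n hy
  obtain ⟨f, hf, hrel⟩ := exists_isFunction hPE hQE (R := R)
    (fun π hπ z hz w hw => hR π hπ z w ((hP.2 z).1 hz).1 ((hQ.2 w).1 hw).1) (by
      intro z hz
      obtain ⟨hzy, hz⟩ := (hP.2 z).1 hz
      obtain ⟨hz, hfin, hn⟩ := hasFiniteCardGT_iff.1 hz
      obtain ⟨w, ⟨h1, h2, h3⟩, huniq⟩ := h z hzy hfin hn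
      refine ⟨w, ⟨(hQ.2 w).2 ⟨⟨h1.1, fun v hv => hzy.2 v (h1.2 v hv)⟩,
        hasCard_iff.2 ⟨h1.1, hfin.subset h1.2, h2⟩⟩, h3⟩, ?_⟩
      rintro w' ⟨h1', h2'⟩
      exact huniq w' ⟨hsub z w' h2', (hasCard_iff.1 ((hQ.2 w').1 h1').2).2.2, h2'⟩)
  exact ⟨P, Q, f, hP, hQ, hf, fun z w hzw => hsub z w ((hrel z w).1 hzw).2.2⟩

/-- A set of the model whose elements have a common finite support is well-orderable. -/
theorem isWellOrderable_of_supports {x : PermutationModel.{u} G} {E : Finset A} (hx : IsSet x)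
    (hE : ∀ z ∈ x, Supports E z) : IsWellOrderable x := by
  have hxE := supports_of_elements hx hE
  -- Any well-ordering of the ambient type restricts to an invariant relation, since permutations
  -- fixing `E` fix `x` pointwise.
  obtain ⟨r, hr, -, hrel⟩ := exists_relation x x WellOrderingRel E hxE hxE (by
    intro π hπ a ha b hb h
    rwa [hE a ha π hπ, hE b hb π hπ])
  refine ⟨r, hr, fun a _ h => ?_, fun a b c ha hb hc h h' => ?_, fun a b ha hb => ?_,
    fun y hy hne => ?_⟩
  · exact irrefl_of WellOrderingRel a ((hrel a a).1 h).2.2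
  · exact (hrel a c).2 ⟨ha, hc, trans_of WellOrderingRel ((hrel a b).1 h).2.2
      ((hrel b c).1 h').2.2⟩
  · rcases trichotomous_of WellOrderingRel a b with h | h | h
    exacts [.inr (.inl ((hrel a b).2 ⟨ha, hb, h⟩)), .inl h, .inr (.inr ((hrel b a).2 ⟨hb, ha, h⟩))]
  · have wf : WellFounded (WellOrderingRel (α := PermutationModel.{u} G)) := IsWellFounded.wf
    refine ⟨wf.min y.elements hne, wf.min_mem y.elements hne, fun b hb => ?_⟩
    rcases trichotomous_of WellOrderingRel (wf.min y.elements hne) b with h | h | h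
    · exact .inr ((hrel _ _).2 ⟨hy.2 _ (wf.min_mem y.elements hne), hy.2 _ hb, h⟩)
    · exact .inl h.symm
    · exact absurd h (wf.not_lt_min y.elements hb)

/-- On a set of the model whose elements have a common finite support there is a selection. -/
theorem exists_selection_of_supports (n : ℕ) {x : PermutationModel.{u} G} {E : Finset A}
    (hx : IsSet x) (hE : ∀ z ∈ x, Supports E z) :
    ∃ P Q f, IsFiniteSubsetsOfCardGT n P x ∧ IsSubsetsOfCard n Q x ∧ IsFunction f P Q ∧
      ∀ z w, Related f z w → IsSubset w z := by
  have hsub : ∀ z, ∃ w : PermutationModel.{u} G, z.elements.Finite → n < z.elements.ncard →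
      IsSubset w z ∧ w.elements.ncard = n := by
    intro z
    by_cases h : n < z.elements.ncard
    · obtain ⟨K, hK, hc⟩ := Set.exists_subset_card_eq h.le
      by_cases hfin : z.elements.Finite
      · obtain ⟨w, hw, rfl⟩ := exists_elements_eq_of_finite (hfin.subset hK)
        exact ⟨w, fun _ _ => ⟨⟨hw, hK⟩, hc⟩⟩
      · exact ⟨z, fun h => absurd h hfin⟩
    · exact ⟨z, fun _ h' => absurd h' h⟩
  choose c hc using hsub
  -- Subsets of `x` are fixed along with its elements, so the external choice `c` is automatically
  -- invariant.
  have hfix : ∀ π ∈ fixing G E, ∀ z, IsSubset z x → π • z = z := fun π hπ z hz =>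
    supports_of_elements hz.1 (fun v hv => hE v (hz.2 v hv)) π hπ
  refine exists_selection (supports_of_elements hx hE) (fun z w => w = c z ∧ IsSubset w z)
    ?_ ?_ fun z w h => h.2
  · intro π hπ z w hz hw h
    rwa [hfix π hπ z hz, hfix π hπ w hw]
  · intro z hz hfin hn
    obtain ⟨h1, h2⟩ := hc z hfin hn
    exact ⟨c z, ⟨h1, h2, rfl, h1⟩, fun w hw => hw.2.2.1⟩

/-- The atoms. -/
def atom (G : Subgroup (Equiv.Perm A)) (a : A) : PermutationModel.{u} G :=
  ⟨ZFA.atom a, _, ⟨{a}, fun π _ hπ => by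
    rw [ZFA.smul_atom, hπ a (Finset.mem_singleton_self a)]⟩,
    fun y hy => absurd hy (ZFA.notMem_atom a y)⟩

theorem atom_injective : Function.Injective (atom.{u} G) := fun _ _ h =>
  ZFA.atom_injective (congrArg Subtype.val h)

theorem isAtom_atom (a : A) : IsAtom (atom.{u} G a) := ZFA.not_isSet_atom a

theorem smul_atom (π : G) (a : A) : π • atom.{u} G a = atom G ((π : Equiv.Perm A) a) := rfl

end PermutationModel

/-! ### Infinite sets in the model built on `F` -/

namespace SelModel

open SetStructure PermutationModel

variable {n : ℕ} {F : SelModel n ℕ}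

/-- A set of `MOD_n` without a common finite support of its elements contains an infinite family
indexed by atoms, without repetition and with a finite support. -/
theorem HasExtensions.exists_family (hF : F.HasExtensions) {x : MOD.{u} F}
    (hx : ¬ ∃ E : Finset ℕ, ∀ z ∈ x, Supports E z) :
    ∃ (E : Finset ℕ) (O : Set ℕ) (V : ℕ → MOD.{u} F), O.Infinite ∧ Set.InjOn V O ∧
      (∀ a ∈ O, V a ∈ x) ∧ ∀ π ∈ fixing F.autGroup E, ∀ a ∈ O,
        (π : Equiv.Perm ℕ) a ∈ O ∧ V ((π : Equiv.Perm ℕ) a) = π • V a := by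
  obtain ⟨E₀, hE₀⟩ := exists_supports x
  obtain ⟨v, hv, hvE₀⟩ : ∃ v ∈ x, ¬ Supports E₀ v := by
    by_contra! h
    exact hx ⟨E₀, h⟩
  obtain ⟨S, hS⟩ := exists_supports v
  obtain ⟨E, b, hE₀E, hb, hbE, hE⟩ : ∃ E b, E₀ ⊆ E ∧ b ∉ E ∧ Supports (insert b E) v ∧
      ¬ Supports E v := by
    -- The points of a support of `v` are discarded one at a time; the first whose loss leaves `v`
    -- unsupported is `b`. This cannot fail to occur, as `E₀` alone does not support `v`.
    have key : ∀ T : Finset ℕ, Supports (E₀ ∪ T) v → ∃ E b, E₀ ⊆ E ∧ b ∉ E ∧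
        Supports (insert b E) v ∧ ¬ Supports E v := by
      intro T
      induction T using Finset.induction_on with
      | empty =>
        intro h
        rw [Finset.union_empty] at h
        exact absurd h hvE₀
      | insert t T _ ih =>
        intro h
        by_cases hT : Supports (E₀ ∪ T) v
        · exact ih hT
        · rw [Finset.union_insert] at h
          refine ⟨E₀ ∪ T, t, Finset.subset_union_left, fun ht => ?_, h, hT⟩
          rw [Finset.insert_eq_self.2 ht] at h
          exact hT h
    exact key S (hS.mono Finset.subset_union_right)
  have hlift : ∀ {E' : Finset ℕ}, Supports E' v ↔
      ∀ π, F.Fixes E' π → π • v.1 = v.1 := fun {E'} =>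
    ⟨fun h π hπ => congrArg Subtype.val (h ⟨π, hπ.1⟩ hπ.2),
      fun h π hπ => Subtype.ext (h π ⟨π.2, hπ⟩)⟩
  have hfix : ∀ π ∈ fixing F.autGroup E, π • v = v → (π : Equiv.Perm ℕ) b = b :=
    fun π hπ h => hF.apply_eq_of_smul_eq hb (hlift.1 hbE) (hlift.not.1 hE) ⟨π.2, hπ⟩
      (congrArg Subtype.val h)
  have hfix' : ∀ π ∈ fixing F.autGroup E, (π : Equiv.Perm ℕ) b = b → π • v = v := by
    intro π hπ h
    refine hbE π fun a ha => ?_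
    rcases Finset.mem_insert.1 ha with rfl | ha
    exacts [h, hπ a ha]
  let O : Set ℕ := {a | ∃ π ∈ fixing F.autGroup E, (π : Equiv.Perm ℕ) b = a}
  have hO : ∀ a : O, ∃ π ∈ fixing F.autGroup E, (π : Equiv.Perm ℕ) b = a := fun a => a.2
  choose ρ hρ hρb using hO
  classical
  let V : ℕ → MOD.{u} F := fun a => if ha : a ∈ O then ρ ⟨a, ha⟩ • v else v
  -- The chosen `ρ` is irrelevant: two permutations with the same value at `b` differ by one fixing
  -- `E ∪ {b}`, hence `v`.
  have hV : ∀ π ∈ fixing F.autGroup E, V ((π : Equiv.Perm ℕ) b) = π • v := by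
    intro π hπ
    have ha : (π : Equiv.Perm ℕ) b ∈ O := ⟨π, hπ, rfl⟩
    simp only [V, dif_pos ha]
    rw [← inv_smul_eq_iff, ← mul_smul]
    refine hfix' _ (mul_mem (inv_mem hπ) (hρ _)) ?_
    change (π : Equiv.Perm ℕ)⁻¹ ((ρ _ : Equiv.Perm ℕ) b) = b
    rw [hρb, Equiv.Perm.inv_eq_iff_eq]
  refine ⟨E, O, V, ?_, ?_, ?_, ?_⟩
  · refine (hF.infinite_orbit hb).mono ?_
    rintro a ⟨π, hπ, rfl⟩
    exact ⟨⟨π, hπ.1⟩, hπ.2, rfl⟩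
  -- Injectivity is the hard direction, `hfix`: a permutation fixing `E` and `v` fixes `b`.
  · rintro _ ⟨π, hπ, rfl⟩ _ ⟨σ, hσ, rfl⟩ h
    rw [hV π hπ, hV σ hσ, ← inv_smul_eq_iff, ← mul_smul] at h
    have h' := hfix _ (mul_mem (inv_mem hσ) hπ) h
    change (σ : Equiv.Perm ℕ)⁻¹ ((π : Equiv.Perm ℕ) b) = b at h'
    rwa [Equiv.Perm.inv_eq_iff_eq] at h'
  · rintro _ ⟨π, hπ, rfl⟩
    rw [hV π hπ]
    have := smul_mem_smul π hv
    rwa [hE₀ π (fixing_anti hE₀E hπ)] at this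
  · rintro π hπ _ ⟨σ, hσ, rfl⟩
    refine ⟨⟨π * σ, mul_mem hπ hσ, rfl⟩, ?_⟩
    rw [hV σ hσ, ← mul_smul]
    exact hV (π * σ) (mul_mem hπ hσ)

/-- The set of the values of a family of elements of `x` indexed by atoms. -/
theorem exists_elements_eq_image {x : MOD.{u} F} {E : Finset ℕ} {O : Set ℕ} {V : ℕ → MOD.{u} F}
    (hVx : ∀ a ∈ O, V a ∈ x) (hV : ∀ π ∈ fixing F.autGroup E, ∀ a ∈ O,
      (π : Equiv.Perm ℕ) a ∈ O ∧ V ((π : Equiv.Perm ℕ) a) = π • V a) :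
    ∃ y, IsSubset y x ∧ Supports E y ∧ y.elements = V '' O := by
  obtain ⟨y, hy, hyE, h⟩ := exists_elements_eq (V '' O) E (by
    rintro π hπ _ ⟨a, ha, rfl⟩
    exact ⟨_, (hV π hπ a ha).1, (hV π hπ a ha).2⟩)
  refine ⟨y, ⟨hy, fun z hz => ?_⟩, hyE, h⟩
  obtain ⟨a, ha, rfl⟩ := (Set.ext_iff.1 h z).1 hz
  exact hVx a ha

/-- The selection of `F` on finite subsets of `O` is carried to `y` along `V`. Injectivity makes it
well defined; it is invariant because `V` is equivariant and automorphisms preserve `F.sel`. -/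
theorem exists_selection_of_family {y : MOD.{u} F} {E : Finset ℕ} {O : Set ℕ} {V : ℕ → MOD.{u} F}
    (hyE : Supports E y) (hinj : Set.InjOn V O) (hyV : y.elements = V '' O)
    (hV : ∀ π ∈ fixing F.autGroup E, ∀ a ∈ O,
      (π : Equiv.Perm ℕ) a ∈ O ∧ V ((π : Equiv.Perm ℕ) a) = π • V a) :
    ∃ P Q f, IsFiniteSubsetsOfCardGT n P y ∧ IsSubsetsOfCard n Q y ∧ IsFunction f P Q ∧
      ∀ z w, Related f z w → IsSubset w z := by
  have hsmul : ∀ π ∈ fixing F.autGroup E, ∀ X : Finset ℕ, (X : Set ℕ) ⊆ O → ∀ z : MOD.{u} F,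
      z.elements = V '' X →
      (π • z).elements = V '' (X.map (π : Equiv.Perm ℕ).toEmbedding : Finset ℕ) := by
    intro π hπ X hX z hz
    rw [elements_smul, hz, Set.image_image, Finset.coe_map, Set.image_image]
    exact Set.image_congr fun a ha => (hV π hπ a (hX ha)).2.symm
  -- Requiring `IsSet w` makes `w` determined by its elements, as uniqueness demands.
  refine exists_selection hyE (fun z w => IsSet w ∧ ∃ X : Finset ℕ, (X : Set ℕ) ⊆ O ∧ n < X.card ∧
    z.elements = V '' X ∧ w.elements = V '' (F.sel X)) ?_ ?_ ?_
  · rintro π hπ z w - - ⟨hw, X, hX, hn, hzX, hwX⟩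
    refine ⟨(isSet_smul π).2 hw, X.map (π : Equiv.Perm ℕ).toEmbedding, ?_, by simpa using hn,
      hsmul π hπ X hX z hzX, ?_⟩
    · intro a ha
      obtain ⟨c, hc, rfl⟩ := Finset.mem_map.1 (Finset.mem_coe.1 ha)
      exact (hV π hπ c (hX hc)).1
    · rw [← π.2 X hn]
      exact hsmul π hπ _ (fun a ha => hX (F.sel_subset X hn ha)) w hwX
  · intro z hz hfin hn
    have hzO : z.elements ⊆ V '' O := hyV ▸ hz.2
    obtain ⟨T, hT, hzT⟩ := Set.subset_image_iff.1 hzO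
    have hTfin : T.Finite := by
      rw [← Set.finite_image_iff (hinj.mono hT), hzT]
      exact hfin
    lift T to Finset ℕ using hTfin
    rw [← hzT, (hinj.mono hT).ncard_image, Set.ncard_coe_finset] at hn
    have hsub := F.sel_subset T hn
    obtain ⟨w, hw, hwT⟩ := exists_elements_eq_of_finite ((F.sel T).finite_toSet.image V)
    refine ⟨w, ⟨⟨hw, fun v hv => ?_⟩, ?_, hw, T, hT, hn, hzT.symm, hwT⟩, ?_⟩
    · rw [← mem_elements, hwT] at hv
      rw [← mem_elements, ← hzT]
      exact Set.image_mono (Finset.coe_subset.2 hsub) hv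
    · have hinj' : Set.InjOn V (F.sel T) := hinj.mono fun a ha => hT (hsub ha)
      rw [hwT, hinj'.ncard_image,
        Set.ncard_coe_finset, F.card_sel T hn]
    · rintro w' ⟨-, -, hw', T', hT', -, hzT', hwT'⟩
      have h : T = T' := by
        rw [← Finset.coe_inj, ← hinj.image_eq_image_iff hT hT', hzT, hzT']
      subst h
      exact elements_injOn hw' hw (hwT'.trans hwT.symm)
  · rintro z w ⟨hw, X, hX, hn, hzX, hwX⟩
    refine ⟨hw, fun v hv => ?_⟩
    rw [← mem_elements, hwX] at hv
    rw [← mem_elements, hzX]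
    exact Set.image_mono (Finset.coe_subset.2 (F.sel_subset X hn)) hv

/-- The values of a family indexed by atoms are in bijection with a set of atoms. -/
theorem exists_isBijection_atoms {y : MOD.{u} F} {E : Finset ℕ} {O : Set ℕ} {V : ℕ → MOD.{u} F}
    (hyE : Supports E y) (hinj : Set.InjOn V O) (hyV : y.elements = V '' O)
    (hV : ∀ π ∈ fixing F.autGroup E, ∀ a ∈ O,
      (π : Equiv.Perm ℕ) a ∈ O ∧ V ((π : Equiv.Perm ℕ) a) = π • V a) :
    ∃ z f : MOD.{u} F, IsSetOfAtoms z ∧ z.elements = PermutationModel.atom.{u} F.autGroup '' O ∧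
      IsBijection f y z := by
  obtain ⟨z, hz, hzE, h⟩ := exists_elements_eq (PermutationModel.atom.{u} F.autGroup '' O) E (by
    rintro π hπ _ ⟨a, ha, rfl⟩
    exact ⟨_, (hV π hπ a ha).1, rfl⟩)
  have hy' : ∀ v, v ∈ y ↔ ∃ a ∈ O, V a = v := fun v => Set.ext_iff.1 hyV v
  have hz' : ∀ v, v ∈ z ↔ ∃ a ∈ O, PermutationModel.atom.{u} F.autGroup a = v :=
    fun v => Set.ext_iff.1 h v
  obtain ⟨f, hf⟩ := exists_isBijection hyE hzE
    (R := fun v w => ∃ a ∈ O, v = V a ∧ w = PermutationModel.atom.{u} F.autGroup a) (by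
      rintro π hπ v - w - ⟨a, ha, rfl, rfl⟩
      exact ⟨_, (hV π hπ a ha).1, (hV π hπ a ha).2.symm, rfl⟩) (by
      intro v hv
      obtain ⟨a, ha, rfl⟩ := (hy' v).1 hv
      refine ⟨_, ⟨(hz' _).2 ⟨a, ha, rfl⟩, a, ha, rfl, rfl⟩, ?_⟩
      rintro w ⟨-, c, hc, hac, rfl⟩
      rw [hinj ha hc hac]) (by
      intro w hw
      obtain ⟨a, ha, rfl⟩ := (hz' w).1 hw
      refine ⟨_, ⟨(hy' _).2 ⟨a, ha, rfl⟩, a, ha, rfl, rfl⟩, ?_⟩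
      rintro v ⟨-, c, hc, rfl, hac⟩
      rw [PermutationModel.atom_injective hac])
  refine ⟨z, f, ⟨hz, fun w hw => ?_⟩, h, hf⟩
  obtain ⟨a, -, rfl⟩ := (hz' w).1 hw
  exact isAtom_atom a

end SelModel

theorem theorem7p2 (n : ℕ) (hn : 0 < n) :
    (∃ F : SelModel n ℕ, F.IsControlledLimit) ∧
    ∀ F : SelModel n ℕ, F.IsControlledLimit →
      F.IsUniversal ∧ F.IsHomogeneous ∧
      SetStructure.ModelsRCfin n (SelModel.MOD.{u} F) ∧
      ∀ x : SelModel.MOD.{u} F, SetStructure.IsInfiniteSet x →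
        SetStructure.IsWellOrderable x ∨
        ∃ y z f : SelModel.MOD.{u} F,
          SetStructure.IsSubset y x ∧ SetStructure.IsInfiniteSet y ∧
          SetStructure.IsSetOfAtoms z ∧ SetStructure.IsInfiniteSet z ∧
          SetStructure.IsBijection f y z := by
  refine ⟨SelModel.exists_isControlledLimit n, ?_⟩
  rintro F ⟨c⟩
  have hF : F.HasExtensions := c.hasExtensions
  refine ⟨hF.isUniversal, hF.isHomogeneous, fun x hx => ?_, fun x hx => ?_⟩
  -- Both remaining claims follow from the same dichotomy: a common finite support for the elements
  -- of `x`, or an infinite family indexed by atoms.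
  · by_cases h : ∃ E : Finset ℕ, ∀ z ∈ x, PermutationModel.Supports E z
    · obtain ⟨E, hE⟩ := h
      exact ⟨x, ⟨hx.1, fun _ h => h⟩, hx,
        PermutationModel.exists_selection_of_supports n hx.1 hE⟩
    · obtain ⟨E, O, V, hO, hinj, hVx, hV⟩ := hF.exists_family h
      obtain ⟨y, hyx, hyE, hyV⟩ := SelModel.exists_elements_eq_image hVx hV
      exact ⟨y, hyx, PermutationModel.isInfiniteSet_iff.2 ⟨hyx.1, hyV ▸ hO.image hinj⟩,
        SelModel.exists_selection_of_family hyE hinj hyV hV⟩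
  · by_cases h : ∃ E : Finset ℕ, ∀ z ∈ x, PermutationModel.Supports E z
    · obtain ⟨E, hE⟩ := h
      exact .inl (PermutationModel.isWellOrderable_of_supports hx.1 hE)
    · obtain ⟨E, O, V, hO, hinj, hVx, hV⟩ := hF.exists_family h
      obtain ⟨y, hyx, hyE, hyV⟩ := SelModel.exists_elements_eq_image hVx hV
      obtain ⟨z, f, hz, hzO, hf⟩ := SelModel.exists_isBijection_atoms hyE hinj hyV hV
      exact .inr ⟨y, z, f, hyx,
        PermutationModel.isInfiniteSet_iff.2 ⟨hyx.1, hyV ▸ hO.image hinj⟩, hz,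
        PermutationModel.isInfiniteSet_iff.2 ⟨hz.1, hzO ▸
          hO.image PermutationModel.atom_injective.injOn⟩, hf⟩
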